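/- Let $k$ be an algebraically closed field, $Q$ a finite acyclic quiver with vertex set $Q_0$, and $\operatorname{rep} Q$ the category of finite-dimensional representations of $Q$ over $k$. Identify $K_0(kQ)$ with $\mathbb{Z}^{Q_0}$, the class of $M$ being its dimension vector $\underline{\dim}\, M = (\dim_k M_x)_{x\in Q_0}$, and let $\operatorname{supp} M=\{x\in Q_0 : M_x\neq 0\}$. Definitions. Subcategories are full and closed under isomorphism. For a representation $T$, $\operatorname{add} T$ consists of the direct summands of the $T^n$ ($n\ge 0$), and $\operatorname{Gen} T$ of the quotients of objects of $\operatorname{add} T$. A representation $T$ is support tilting if it has projective dimension at most $1$, $\operatorname{Ext}^1(T,T)=0$, and every $M$ with $\operatorname{supp} M\subseteq\operatorname{supp} T$ and $\operatorname{Ext}^1(T,M)=0$ lies in $\operatorname{Gen} T$. For a subcategory $\mathcal T$, an object $P\in\mathcal T$ is split projective in $\mathcal T$ if every epimorphism $I\to P$ with $I\in\mathcal T$ splits, and Ext-projective in $\mathcal T$ if $\operatorname{Ext}^1(P,I)=0$ for all $I\in\mathcal T$; and $\mathfrak a(\mathcal T)$ consists of those $B\in\mathcal T$ such that $\ker g\in\mathcal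 T$ for every morphism $g:Y\to B$ with $Y\in\mathcal T$. For a homomorphism $\theta:K_0(kQ)\to\mathbb Z$, $\theta_{ss}$ consists of those $V$ with $\theta(\underline{\dim}\,V)=0$ and $\theta(\underline{\dim}\,W)\le 0$ for every subrepresentation $W\subseteq V$. A subcategory is wide if it contains $0$ and is closed under kernels, cokernels and extensions; it is finitely generated if it contains finitely many indecomposable objects $G_1,\dots,G_n$ such that each of its objects lies in $\operatorname{Gen}(\bigoplus_i G_i)$. Theorem. The spaces $\operatorname{Hom}(M,N)$ and $\operatorname{Ext}^1(M,N)$ are finite-dimensional for all $M,N\in\operatorname{rep} Q$. Put $\langle M,N\rangle=\dim_k\operatorname{Hom}(M,N)-\dim_k\operatorname{Ext}^1(M,N)$. (1) Let $T=\bigoplus_{i=1}^r T_i$ be a basic support tilting representation, with the $T_i$ indecomposable and pairwise non-isomorphic. Let $a_1,\dots,a_r$ and $b_j$ ($j\in Q_0\setminus\operatorname{supp} T$) be integers such that $a_i=0$ if $T_i$ is split projective in $\operatorname{Gen} T$, $a_i>0$ if $T_i$ is Ext-projective but not split projective in $\operatorname{Gen} T$, and $b_j<0$ for every $j$. Then there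 is exactly one homomorphism $\theta:K_0(kQ)\to\mathbb Z$ with $$\theta(\underline{\dim}\, M)=\sum_{i=1}^r a_i\langle T_i,M\rangle+\sum_{j\in Q_0\setminus\operatorname{supp} T} b_j\dim_k M_j\qquad\text{for all } M\in\operatorname{rep} Q,$$ and for this $\theta$ one has $\mathfrak a(\operatorname{Gen} T)=\theta_{ss}$. (2) Every finitely generated wide subcategory of $\operatorname{rep} Q$ equals $\theta_{ss}$ for some homomorphism $\theta:K_0(kQ)\to\mathbb Z$. -/

import Mathlib

open CategoryTheory CategoryTheory.Limits

universe u v w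

attribute [local instance] Abelian.hasFiniteBiproducts

namespace QuiverRep

noncomputable section

/-- The category `rep Q` of finite-dimensional representations of the quiver `Q` over the field
`k`: functors from the path category of `Q` to finite-dimensional `k`-vector spaces. -/
abbrev Rep (k : Type u) [Field k] (Q : Type v) [Quiver.{w} Q] :=
  Paths Q ⥤ FGModuleCat.{u} k

/-- A quiver is acyclic if it has no oriented cycles: every path from a vertex to itself is
trivial. -/
def IsAcyclic (Q : Type v) [Quiver.{w} Q] : Prop :=
  ∀ (x : Q) (p : Quiver.Path x x), p.length = 0

instance (k : Type u) [Field k] (Q : Type v) [Quiver.{w} Q] :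
    HasExt.{max (u + 1) v w} (Rep k Q) :=
  HasExt.standard (Rep k Q)

/-- The `k`-vector space `Ext¹(M, N)` in the abelian category `rep Q`. -/
abbrev Ext1 {k : Type u} [Field k] {Q : Type v} [Quiver.{w} Q] (M N : Rep k Q) :
    Type (max (u + 1) v w) :=
  Abelian.Ext M N 1

section Subcategories

variable {C : Type*} [Category C] [Abelian C]

/-- `add T`: the direct summands of finite direct sums of copies of `T`. -/
def add (T : C) : ObjectProperty C :=
  fun X => ∃ n : ℕ, Nonempty (Retract X (⨁ fun _ : Fin n => T))

/-- `Gen T`: the quotients of objects of `add T`. -/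
def Gen (T : C) : ObjectProperty C :=
  fun X => ∃ (Y : C) (p : Y ⟶ X), add T Y ∧ Epi p

/-- `𝔞(𝒯)`: the objects `B` of `𝒯` such that every morphism to `B` from an object of `𝒯` has its
kernel in `𝒯`. -/
def wideOf (𝒯 : ObjectProperty C) : ObjectProperty C :=
  fun B => 𝒯 B ∧ ∀ (Y : C) (g : Y ⟶ B), 𝒯 Y → 𝒯 (kernel g)

/-- A wide subcategory: a full subcategory which contains zero and is closed under kernels,
cokernels (that is, an exact abelian subcategory) and extensions. -/
structure IsWide (A : ObjectProperty C) : Prop where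
  containsZero : A.ContainsZero
  closedUnderKernels : A.IsClosedUnderKernels
  closedUnderCokernels : A.IsClosedUnderCokernels
  closedUnderExtensions : A.IsClosedUnderExtensions

/-- A subcategory is finitely generated if finitely many of its indecomposable objects
generate it. -/
def IsFinitelyGenerated (A : ObjectProperty C) : Prop :=
  ∃ (n : ℕ) (G : Fin n → C),
    (∀ i, Indecomposable (G i)) ∧ (∀ i, A (G i)) ∧ A ≤ Gen (⨁ G)

/-- `P` is split projective in `𝒯`: every epimorphism onto `P` from an object of `𝒯` splits. -/
def IsSplitProjective (𝒯 : ObjectProperty C) (P : C) : Prop :=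
  𝒯 P ∧ ∀ (I : C) (p : I ⟶ P), 𝒯 I → Epi p → IsSplitEpi p

end Subcategories

section Rep

variable {k : Type u} [Field k] {Q : Type v} [Quiver.{w} Q]

/-- `P` is Ext-projective in `𝒯`: `Ext¹(P, I) = 0` for all `I` in `𝒯`. -/
def IsExtProjective (𝒯 : ObjectProperty (Rep k Q)) (P : Rep k Q) : Prop :=
  𝒯 P ∧ ∀ I : Rep k Q, 𝒯 I → Subsingleton (Ext1 P I)

/-- The dimension `dim_k M_x` of a representation at the vertex `x`. -/
def dimAt (M : Rep k Q) (x : Q) : ℕ :=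
  Module.finrank k (M.obj x)

/-- The Grothendieck group `K₀(kQ)`, with its basis indexed by the vertices of `Q`. -/
abbrev K0 (Q : Type v) := Q → ℤ

/-- The dimension vector, that is, the class of `M` in `K₀(kQ)`. -/
def dimVec (M : Rep k Q) : K0 Q :=
  fun x => dimAt M x

/-- The support of a representation: the vertices `x` for which the simple representation at `x`
is a composition factor, that is, `M_x ≠ 0`. -/
def supp (M : Rep k Q) : Set Q :=
  {x | dimAt M x ≠ 0}

/-- The Euler pairing `dim Hom(M, N) - dim Ext¹(M, N)`. -/
def euler (M N : Rep k Q) : ℤ :=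
  (Module.finrank k (M ⟶ N) : ℤ) - (Module.finrank k (Ext1 M N) : ℤ)

/-- Partial tilting modules. -/
structure IsPartialTilting (T : Rep k Q) : Prop where
  ext_self : Subsingleton (Ext1 T T)
  projectiveDimension_le : HasProjectiveDimensionLE T 1

/-- Support tilting modules: partial tilting modules `T` such that every `M` with
`supp M ⊆ supp T` and `Ext¹(T, M) = 0` lies in `Gen T`. -/
structure IsSupportTilting (T : Rep k Q) : Prop extends IsPartialTilting T where
  gen_of_ext : ∀ M : Rep k Q,
    supp M ⊆ supp T → Subsingleton (Ext1 T M) → Gen T M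

/-- `θ_ss`: the representations `V` with `θ(V) = 0` and `θ(W) ≤ 0` for all subrepresentations `W`
of `V`. -/
def semistable (k : Type u) [Field k] (θ : K0 Q →+ ℤ) : ObjectProperty (Rep k Q) :=
  fun V => θ (dimVec V) = 0 ∧ ∀ (W : Rep k Q) (i : W ⟶ V), Mono i → θ (dimVec W) ≤ 0

open Classical in
/-- `θ = ∑ᵢ aᵢ ⟨Tᵢ, -⟩ + ∑ⱼ bⱼ eⱼ` as a function on the classes of representations, where `j` runs
over the vertices outside the support of `⨁ Tᵢ`. -/
def IsStabilityOf [Fintype Q] {r : ℕ} (T : Fin r → Rep k Q) (a : Fin r → ℤ) (b : Q → ℤ)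
    (θ : K0 Q →+ ℤ) : Prop :=
  ∀ M : Rep k Q,
    θ (dimVec M) = ∑ i, a i * euler (T i) M
      + ∑ j ∈ Finset.univ.filter (fun j => j ∉ supp (⨁ T)), b j * (dimAt M j : ℤ)

end Rep

end

end QuiverRep

/-!
Stability and torsion classes for an acyclic quiver `Q`. Everything rests on heredity: a simple
representation has a projective resolution of length one (`simple.exists_resolution`), and every
representation is built from simple ones, so `Ext²` vanishes (`ext_two`). Hence `Ext¹(T, -)` is
right exact, the Euler pairing is additive on short exact sequences (`euler_shortExact`), and an
additive function of representations is a linear function of the dimension vector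
(`existsUnique_dimVec`). This gives the existence and uniqueness of `θ`.

Let `T = ⨁ T i` be support tilting. Then `Gen T` is the torsion class of the representations `M`
supported on `T` with `Ext¹(T, M) = 0`. On a torsion object `θ` is `∑ a i * dim Hom(T i, -) ≥ 0`,
with equality precisely when every `T i` mapping nontrivially to it is split projective. On a
torsion-free object `θ` is `-∑ a i * dim Ext¹(T i, -)` plus a negative multiple of each dimension
outside the support, hence is nonpositive. Two facts make `θ` see exactly `𝔞(Gen T)`.
* An object of `𝔞(Gen T)` receives no nonzero morphism from a `T i` which is not split projective
  (`IsTiltingFamily.hom_eq_zero_of_wideOf`, by Fitting's lemma).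
* The vanishing of `Ext¹(T i, X)` for those `T i` which are not split projective already forces an
  `X` supported on `T` into `Gen T` (`IsTiltingFamily.gen_of_ext_nonsplit`), because an extension
  of a split projective object by `X` splits once its middle term is in `Gen T`.

The first shows that objects of `𝔞(Gen T)` are semistable. Conversely, for semistable `B` the
torsion-free quotient `F` has `θ F = 0`, and the second fact puts `F`, hence `B`, in `Gen T`; for
`g : Y ⟶ B` with `Y` torsion the image of `g` is torsion and a subobject of `B`, so `θ` vanishes
on it, and the second fact applies to the kernel of `g`. This is `IsTiltingFamily.wideOf_iff`.

For a finitely generated wide subcategory `A`, a minimal generating family consists of split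
projective objects of the extension-closed class `Gen A`, which are therefore Ext-projective.
Adding the cokernel of a left approximation of a projective generator completes their sum to a
support tilting representation generating the same class (`exists_extProjective_completion`), and
`A` is recovered as `𝔞(Gen A)` (`IsWide.wideOf_gen`), so that the first part applies.
-/

namespace QuiverRep

open Abelian (Ext)

/-! ### Vanishing of Ext along short exact sequences -/

section ExtVanishing

variable {C : Type*} [Category C] [Abelian C] [HasExt.{w} C]
variable {S : ShortComplex C} (hS : S.ShortExact)
include hS

lemma exists_lift_of_ext_eq_zero {X : C} (h : Subsingleton (Ext X S.X₁ 1)) (f : X ⟶ S.X₃) :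
    ∃ g : X ⟶ S.X₂, g ≫ S.g = f := by
  obtain ⟨x, hx⟩ := Ext.covariant_sequence_exact₃ X hS (Ext.mk₀ f) (zero_add 1)
    (Subsingleton.elim _ _)
  refine ⟨Ext.addEquiv₀ x, (Ext.mk₀_bijective _ _).1 ?_⟩
  rw [← hx, ← Ext.mk₀_comp_mk₀, Ext.mk₀_addEquiv₀_apply]

lemma exists_extend_of_ext_eq_zero {Y : C} (h : Subsingleton (Ext S.X₃ Y 1)) (f : S.X₁ ⟶ Y) :
    ∃ g : S.X₂ ⟶ Y, S.f ≫ g = f := by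
  obtain ⟨x, hx⟩ := Ext.contravariant_sequence_exact₁ hS Y (Ext.mk₀ f) (add_zero 1)
    (Subsingleton.elim _ _)
  refine ⟨Ext.addEquiv₀ x, (Ext.mk₀_bijective _ _).1 ?_⟩
  rw [← hx, ← Ext.mk₀_comp_mk₀, Ext.mk₀_addEquiv₀_apply]

lemma ext_X₂_right {X : C} {n : ℕ} (h₁ : Subsingleton (Ext X S.X₁ n))
    (h₃ : Subsingleton (Ext X S.X₃ n)) : Subsingleton (Ext X S.X₂ n) := by
  refine subsingleton_of_forall_eq 0 fun x => ?_
  obtain ⟨y, rfl⟩ := Ext.covariant_sequence_exact₂ X hS x (Subsingleton.elim _ _)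
  rw [Subsingleton.elim y 0, Ext.zero_comp]

lemma ext_X₃_right {X : C} {n m : ℕ} (hm : n + 1 = m) (h₁ : Subsingleton (Ext X S.X₁ m))
    (h₂ : Subsingleton (Ext X S.X₂ n)) : Subsingleton (Ext X S.X₃ n) := by
  refine subsingleton_of_forall_eq 0 fun x => ?_
  obtain ⟨y, rfl⟩ := Ext.covariant_sequence_exact₃ X hS x hm (Subsingleton.elim _ _)
  rw [Subsingleton.elim y 0, Ext.zero_comp]

lemma ext_X₁_right_of_hom {X : C} (h₃ : ∀ f : X ⟶ S.X₃, f = 0)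
    (h₂ : Subsingleton (Ext X S.X₂ 1)) : Subsingleton (Ext X S.X₁ 1) := by
  refine subsingleton_of_forall_eq 0 fun x => ?_
  obtain ⟨y, rfl⟩ := Ext.covariant_sequence_exact₁ X hS x (Subsingleton.elim _ _) (zero_add 1)
  rw [← Ext.mk₀_addEquiv₀_apply y, h₃ (Ext.addEquiv₀ y), Ext.mk₀_zero, Ext.zero_comp]

lemma ext_X₁_left {Y : C} {n m : ℕ} (hm : 1 + n = m) (h₂ : Subsingleton (Ext S.X₂ Y n))
    (h₃ : Subsingleton (Ext S.X₃ Y m)) : Subsingleton (Ext S.X₁ Y n) := by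
  refine subsingleton_of_forall_eq 0 fun x => ?_
  obtain ⟨y, rfl⟩ := Ext.contravariant_sequence_exact₁ hS Y x hm (Subsingleton.elim _ _)
  rw [Subsingleton.elim y 0, Ext.comp_zero]

lemma ext_X₃_left_of_extend {Y : C} (h₁ : ∀ f : S.X₁ ⟶ Y, ∃ g : S.X₂ ⟶ Y, S.f ≫ g = f)
    (h₂ : Subsingleton (Ext S.X₂ Y 1)) : Subsingleton (Ext S.X₃ Y 1) := by
  refine subsingleton_of_forall_eq 0 fun x => ?_
  obtain ⟨y, rfl⟩ := Ext.contravariant_sequence_exact₃ hS Y x (Subsingleton.elim _ _) (add_zero 1)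
  obtain ⟨g, hg⟩ := h₁ (Ext.addEquiv₀ y)
  rw [← Ext.mk₀_addEquiv₀_apply y, ← hg, ← Ext.mk₀_comp_mk₀,
    ← Ext.comp_assoc (a₁₂ := 1) _ _ _ (by lia) (by lia) (by lia), hS.extClass_comp, Ext.zero_comp]

end ExtVanishing

section Pushout

variable {C : Type*} [Category C] [Abelian C]

/-- The pushout of a short exact sequence along a morphism from its left term. -/
lemma shortExact_of_isPushout {X₁ X₂ X₃ Y E : C} {i : X₁ ⟶ X₂} {p : X₂ ⟶ X₃} {z : i ≫ p = 0}
    (hS : (ShortComplex.mk i p z).ShortExact) {f : X₁ ⟶ Y} {l : X₂ ⟶ E} {j : Y ⟶ E}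
    (h : IsPushout i f l j) {q : E ⟶ X₃} (hl : l ≫ q = p) (hj : j ≫ q = 0) :
    (ShortComplex.mk j q hj).ShortExact := by
  have : Mono i := hS.mono_f
  have : Epi p := hS.epi_g
  have : Epi q := epi_of_epi_fac hl
  have : Mono j := Abelian.mono_inr_of_isColimit i f h.isColimit
  refine { exact := ?_ }
  have key : ∀ {Z : C} (g : E ⟶ Z), j ≫ g = 0 → ∃ m : X₃ ⟶ Z, q ≫ m = g := by
    intro Z g hg
    have h0 : i ≫ l ≫ g = 0 := by rw [← Category.assoc, h.w, Category.assoc, hg, comp_zero]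
    have hm : p ≫ hS.gIsCokernel.desc (CokernelCofork.ofπ (l ≫ g) h0) = l ≫ g :=
      hS.gIsCokernel.fac (CokernelCofork.ofπ _ _) WalkingParallelPair.one
    refine ⟨hS.gIsCokernel.desc (CokernelCofork.ofπ (l ≫ g) h0), h.hom_ext ?_ ?_⟩
    · rw [← Category.assoc, hl]
      exact hm
    · rw [← Category.assoc, hj, hg, zero_comp]
  choose! m hm using @key
  refine ShortComplex.exact_of_g_is_cokernel _ (CokernelCofork.IsColimit.ofπ _ _
    (fun g hg => m g) (fun g hg => hm g hg) ?_)
  intro Z g hg m' hm'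
  rw [← cancel_epi q, hm g hg]
  exact hm'

end Pushout

section ExtRetract

variable {C : Type*} [Category C] [Abelian C] [HasExt.{w} C]

lemma ext_retract_left {X X' Y : C} {n : ℕ} (r : Retract X' X) (h : Subsingleton (Ext X Y n)) :
    Subsingleton (Ext X' Y n) := by
  refine subsingleton_of_forall_eq 0 fun x => ?_
  rw [← Ext.mk₀_id_comp x, ← r.retract, ← Ext.mk₀_comp_mk₀_assoc,
    Subsingleton.elim ((Ext.mk₀ r.r).comp x (zero_add n)) 0, Ext.comp_zero]

lemma ext_biproduct_left {ι : Type*} [Finite ι] {T : ι → C} {Y : C} {n : ℕ}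
    (h : ∀ i, Subsingleton (Ext (T i) Y n)) : Subsingleton (Ext (⨁ T) Y n) := by
  have := Fintype.ofFinite ι
  exact (Ext.biproductAddEquiv (biproduct.isBilimit T) Y n).toEquiv.subsingleton

lemma ext_biproduct_right {ι : Type*} [Finite ι] {T : ι → C} {X : C} {n : ℕ}
    (h : ∀ i, Subsingleton (Ext X (T i) n)) : Subsingleton (Ext X (⨁ T) n) := by
  have := Fintype.ofFinite ι
  exact (Ext.addEquivBiproduct X (biproduct.isBilimit T) n).toEquiv.subsingleton

/-- A summand of a finite direct sum is a retract of it. -/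
noncomputable def retractBiproduct {ι : Type*} [Finite ι] (T : ι → C) (i : ι) :
    Retract (T i) (⨁ T) where
  i := biproduct.ι T i
  r := biproduct.π T i

/-- Every class in `Ext¹(X, Y)` is the class of a short exact sequence: the pushout, along a
suitable map, of a sequence `0 ⟶ K ⟶ P ⟶ X ⟶ 0` with `P` projective. -/
lemma exists_shortExact_extClass_eq [EnoughProjectives C] {X Y : C} (ξ : Ext X Y 1) :
    ∃ (E : C) (f : Y ⟶ E) (g : E ⟶ X) (z : f ≫ g = 0)
      (hS : (ShortComplex.mk f g z).ShortExact), hS.extClass = ξ := by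
  have hS : (ShortComplex.mk (kernel.ι (Projective.π X)) (Projective.π X)
      (kernel.condition _)).ShortExact :=
    { exact := ShortComplex.exact_kernel _ }
  obtain ⟨y, hy⟩ := Ext.contravariant_sequence_exact₃ hS Y ξ (Ext.eq_zero_of_projective _)
    (add_zero 1)
  obtain ⟨φ, rfl⟩ := (Ext.mk₀_bijective _ _).2 y
  have hw : kernel.ι (Projective.π X) ≫ Projective.π X = φ ≫ (0 : Y ⟶ X) := by simp
  have hpo := IsPushout.of_hasPushout (kernel.ι (Projective.π X)) φ
  have hT := shortExact_of_isPushout hS hpo (pushout.inl_desc _ _ hw) (pushout.inr_desc _ _ hw)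
  refine ⟨_, _, _, _, hT, ?_⟩
  have := ShortComplex.ShortExact.extClass_naturality hS hT
    { τ₁ := φ, τ₂ := pushout.inl _ _, τ₃ := 𝟙 _, comm₁₂ := hpo.w.symm,
      comm₂₃ := (pushout.inl_desc _ _ hw).trans (Category.comp_id _).symm }
  rw [← hy]
  exact (this.trans (Ext.mk₀_id_comp _)).symm

end ExtRetract

/-! ### Subcategories generated by an object -/

section Gen

variable {C : Type*} [Category C] [Abelian C]

lemma Gen.exists_epi {T X : C} (h : Gen T X) :
    ∃ (n : ℕ) (p : (⨁ fun _ : Fin n => T) ⟶ X), Epi p := by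
  obtain ⟨Y, p, ⟨n, ⟨r⟩⟩, hp⟩ := h
  have : IsSplitEpi r.r := ⟨⟨r.splitEpi⟩⟩
  exact ⟨n, r.r ≫ p, inferInstance⟩

lemma Gen.of_epi_biproduct {T X : C} {n : ℕ} (p : (⨁ fun _ : Fin n => T) ⟶ X) [Epi p] :
    Gen T X :=
  ⟨_, p, ⟨n, ⟨Retract.refl _⟩⟩, inferInstance⟩

lemma Gen.eq_zero {T X W : C} (hX : Gen T X) (h : X ⟶ W) (hT : ∀ f : T ⟶ X, f ≫ h = 0) :
    h = 0 := by
  obtain ⟨n, p, hp⟩ := hX.exists_epi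
  rw [← cancel_epi p, comp_zero]
  refine biproduct.hom_ext' _ _ fun i => ?_
  rw [← Category.assoc, hT, comp_zero]

lemma Gen.eq_zero_of_biproduct {ι : Type*} [Finite ι] {T : ι → C} {X W : C}
    (hX : Gen (⨁ T) X) (h : X ⟶ W) (hT : ∀ i (f : T i ⟶ X), f ≫ h = 0) : h = 0 := by
  refine hX.eq_zero h fun f => biproduct.hom_ext' _ _ fun i => ?_
  rw [← Category.assoc, hT, comp_zero]

lemma Gen.of_epi {T X Y : C} (hX : Gen T X) (q : X ⟶ Y) [Epi q] : Gen T Y := by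
  obtain ⟨n, p, hp⟩ := hX.exists_epi
  exact Gen.of_epi_biproduct (p ≫ q)

lemma gen_self (T : C) : Gen T T := by
  have : Epi (biproduct.desc fun _ : Fin 1 => 𝟙 T) := by
    refine Preadditive.epi_of_cancel_zero _ fun g hg => ?_
    have := congrArg (biproduct.ι (fun _ : Fin 1 => T) 0 ≫ ·) hg
    simpa using this
  exact Gen.of_epi_biproduct (biproduct.desc fun _ : Fin 1 => 𝟙 T)

lemma gen_biproduct {ι : Type*} [Finite ι] (T : ι → C) (i : ι) : Gen (⨁ T) (T i) :=
  (gen_self _).of_epi (biproduct.π T i)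

variable (k : Type*) [Field k] [Linear k C]

/-- When `Hom(T, X)` is finite-dimensional, `X` lies in `Gen T` as soon as the morphisms from `T`
to `X` are jointly epimorphic, because a basis of `Hom(T, X)` assembles to one epimorphism. -/
lemma gen_of_jointly_epi {T X : C} [Module.Finite k (T ⟶ X)]
    (h : ∀ (W : C) (h : X ⟶ W), (∀ f : T ⟶ X, f ≫ h = 0) → h = 0) : Gen T X := by
  let b := Module.finBasis k (T ⟶ X)
  have : Epi (biproduct.desc b) := by
    refine Preadditive.epi_of_cancel_zero _ fun {W} g hg => h W g fun f => ?_
    have h0 : Linear.rightComp k T g = 0 := b.ext fun i => by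
      have := congrArg (biproduct.ι (fun _ => T) i ≫ ·) hg
      simpa using this
    exact LinearMap.congr_fun h0 f
  exact Gen.of_epi_biproduct (biproduct.desc b)

lemma Gen.of_gen {T T' X : C} [Module.Finite k (T ⟶ X)] (hT : Gen T T') (hX : Gen T' X) :
    Gen T X :=
  gen_of_jointly_epi k fun _ h hh => hX.eq_zero h fun f => hT.eq_zero _ fun g => by
    rw [← Category.assoc, hh]

/-- The trace of `T` in `V`, as the left term of a short exact sequence. -/
lemma exists_trace (T V : C) [Module.Finite k (T ⟶ V)] :
    ∃ (W F : C) (i : W ⟶ V) (p : V ⟶ F) (z : i ≫ p = 0),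
      (ShortComplex.mk i p z).ShortExact ∧ Gen T W ∧ ∀ f : T ⟶ V, f ≫ p = 0 := by
  let b := Module.finBasis k (T ⟶ V)
  let e := biproduct.desc b
  refine ⟨Abelian.image e, cokernel e, Abelian.image.ι e, cokernel.π e, kernel.condition _,
    { exact := ShortComplex.exact_kernel _ }, Gen.of_epi_biproduct (Abelian.factorThruImage e),
    fun f => ?_⟩
  have h0 : Linear.rightComp k T (cokernel.π e) = 0 := b.ext fun i => by
    change b i ≫ cokernel.π e = 0
    rw [← biproduct.ι_desc (f := fun _ => T) b i, Category.assoc, cokernel.condition, comp_zero]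
  exact LinearMap.congr_fun h0 f

lemma gen_biprod {T X Y : C} [Module.Finite k (T ⟶ X ⊞ Y)] (hX : Gen T X) (hY : Gen T Y) :
    Gen T (X ⊞ Y) := by
  refine gen_of_jointly_epi k fun W h hh => biprod.hom_ext' _ _ ?_ ?_
  · rw [comp_zero]
    exact hX.eq_zero _ fun f => by rw [← Category.assoc, hh]
  · rw [comp_zero]
    exact hY.eq_zero _ fun f => by rw [← Category.assoc, hh]

end Gen

/-! ### Endomorphisms of indecomposable objects -/

section Fitting

/-- In a commutative Artinian ring some power of `a` generates an idempotent ideal; then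
`a ^ (n + 1) * y` is an idempotent. -/
lemma exists_pow_eq_mul_pow {R : Type*} [CommRing R] [IsArtinianRing R] (a : R) :
    ∃ (n : ℕ) (y : R), a ^ (n + 1) = a ^ (n + 1) * a ^ (n + 1) * y := by
  obtain ⟨n, y, hy⟩ := IsArtinian.exists_pow_succ_smul_dvd a (1 : R)
  simp only [smul_eq_mul, mul_one] at hy
  have key : ∀ m, a ^ (n + m) * y ^ m = a ^ n := by
    intro m
    induction m with
    | zero => simp
    | succ m ih =>
      have : a ^ (n + (m + 1)) * y ^ (m + 1) = a ^ m * y ^ m * (a ^ n.succ * y) := by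
        rw [Nat.succ_eq_add_one]; ring
      rw [this, hy]
      exact (by ring : _ = a ^ (n + m) * y ^ m).trans ih
  refine ⟨n, y ^ (n + 1), ?_⟩
  calc a ^ (n + 1) = a * a ^ n := by ring
    _ = a * (a ^ (n + (n + 1)) * y ^ (n + 1)) := by rw [key]
    _ = _ := by ring

variable {C : Type*} [Category C] [Abelian C]

lemma eq_zero_or_eq_id_of_indecomposable {X : C} (hX : Indecomposable X) {e : X ⟶ X}
    (he : e ≫ e = e) : e = 0 ∨ e = 𝟙 X := by
  obtain ⟨Y, i, p, hip, hpi⟩ := IsIdempotentComplete.idempotents_split X e he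
  obtain ⟨Z, j, q, hjq, hqj⟩ := IsIdempotentComplete.idempotents_split X (𝟙 X - e)
    (by simp [he])
  have hiq : i ≫ q = 0 := by
    have : i ≫ q = (i ≫ p ≫ i) ≫ (q ≫ j) ≫ q := by simp [hjq, reassoc_of% hip]
    rw [this, hqj, hpi]
    have : i ≫ e = i := by rw [← hpi, reassoc_of% hip]
    rw [this, Preadditive.sub_comp, Category.id_comp, Preadditive.comp_sub,
      reassoc_of% this, sub_self]
  have hjp : j ≫ p = 0 := by
    have h1 : j ≫ (𝟙 X - e) = j := by rw [← hqj, reassoc_of% hjq]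
    have h2 : e ≫ p = p := by rw [← hpi, Category.assoc, hip, Category.comp_id]
    have : j ≫ e = 0 := by simpa using h1
    rw [← h2, reassoc_of% this, zero_comp]
  rcases hX.2 Y Z ⟨biprod.lift p q, biprod.desc i j, by simp [hpi, hqj],
    by ext <;> simp [hip, hjq, hiq, hjp]⟩ with h | h
  · left
    rw [← hpi, h.eq_of_tgt p 0, zero_comp]
  · right
    have : 𝟙 X - e = 0 := by rw [← hqj, h.eq_of_tgt q 0, zero_comp]
    exact (sub_eq_zero.1 this).symm

variable (k : Type*) [Field k] [Linear k C]

/-- Fitting's lemma: an endomorphism of an indecomposable object is nilpotent or invertible. -/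
lemma isIso_or_isNilpotent {X : C} [Module.Finite k (X ⟶ X)] (hX : Indecomposable X)
    (u : End X) : IsIso u ∨ IsNilpotent u := by
  have : Module.Finite k (End X) := ‹Module.Finite k (X ⟶ X)›
  let a : Algebra.adjoin k {u} := ⟨u, Algebra.subset_adjoin rfl⟩
  have := Algebra.isMulCommutative_adjoin k (A := End X) (s := {u}) (by rintro x rfl y rfl; rfl)
  have : IsArtinianRing (Algebra.adjoin k {u}) := isArtinian_of_tower k inferInstance
  obtain ⟨n, y, hy⟩ := exists_pow_eq_mul_pow a
  have he : (a ^ (n + 1) * y) * (a ^ (n + 1) * y) = a ^ (n + 1) * y := by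
    calc _ = a ^ (n + 1) * a ^ (n + 1) * y * y := by ring
      _ = _ := by rw [← hy]
  have he' : (u ^ (n + 1) * y : End X) * (u ^ (n + 1) * y) = u ^ (n + 1) * y :=
    congrArg Subtype.val he
  have hy' : u ^ (n + 1) = u ^ (n + 1) * u ^ (n + 1) * (y : End X) := congrArg Subtype.val hy
  rcases eq_zero_or_eq_id_of_indecomposable hX he' with h | h
  · right
    refine ⟨n + 1, ?_⟩
    rw [hy', mul_assoc]
    erw [h]
    exact mul_zero _
  · left
    have h1 : a ^ (n + 1) * y = 1 := Subtype.ext h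
    have h2 : IsUnit a := IsUnit.of_mul_eq_one (a ^ n * y) (by rw [← h1]; ring)
    exact (isUnit_iff_isIso u).1 (h2.map (Algebra.adjoin k {u}).val)

/-- A nilpotent endomorphism fixes no nonzero morphism. -/
lemma isIso_of_comp_eq_self {X W : C} [Module.Finite k (X ⟶ X)] (hX : Indecomposable X)
    {u : X ⟶ X} {h : X ⟶ W} (h0 : h ≠ 0) (hu : u ≫ h = h) : IsIso u := by
  refine (isIso_or_isNilpotent k hX u).resolve_right fun ⟨n, hn⟩ => h0 ?_
  let v : End X := u
  have : ∀ m : ℕ, (v ^ m : End X) ≫ h = h := by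
    intro m
    induction m with
    | zero => exact Category.id_comp h
    | succ m ih => rw [pow_succ, End.mul_def, Category.assoc, ih, hu]
  rw [← this n, show v ^ n = 0 from hn]
  exact zero_comp

end Fitting

/-! ### Wide subcategories and their torsion classes -/

section Wide

lemma isSplitEpi_of_comp_isIso {C : Type*} [Category C] {X Y Z : C} (f : X ⟶ Y) (p : Y ⟶ Z)
    [IsIso (f ≫ p)] : IsSplitEpi p :=
  ⟨⟨⟨inv (f ≫ p) ≫ f, by simp⟩⟩⟩

variable {C : Type*} [Category C] [Abelian C]

lemma kernel_shortExact {X Y : C} (p : X ⟶ Y) [Epi p] :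
    (ShortComplex.mk (kernel.ι p) p (kernel.condition p)).ShortExact :=
  { exact := ShortComplex.exact_kernel p }

lemma IsWide.prop_of_iso {A : ObjectProperty C} (hA : IsWide A) {X Y : C} (e : X ≅ Y) (hX : A X) :
    A Y := by
  have := hA.closedUnderExtensions
  obtain ⟨Z, hZ, hAZ⟩ := hA.containsZero
  exact A.prop_X₂_of_shortExact (S := ShortComplex.mk e.hom (0 : Y ⟶ Z) comp_zero)
    { exact := (ShortComplex.exact_iff_epi _ rfl).2 inferInstance
      epi_g := hZ.epi _ } hX hAZ

lemma IsWide.prop_biproduct {A : ObjectProperty C} (hA : IsWide A) :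
    ∀ {n : ℕ} (X : Fin n → C), (∀ i, A (X i)) → A (⨁ X) := by
  have := hA.closedUnderExtensions
  intro n
  induction n with
  | zero =>
    intro X _
    obtain ⟨Z, hZ, hAZ⟩ := hA.containsZero
    have h0 : IsZero (⨁ X) := by
      rw [IsZero.iff_id_eq_zero]
      exact biproduct.hom_ext _ _ fun i => i.elim0
    exact hA.prop_of_iso (hZ.iso h0) hAZ
  | succ n ih =>
    intro X hX
    refine hA.prop_of_iso ?_ (A.prop_biprod (hX 0) (ih (fun i => X i.succ) fun i => hX _))
    refine ⟨biprod.desc (biproduct.ι X 0) (biproduct.desc fun i => biproduct.ι X i.succ),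
      biprod.lift (biproduct.π X 0) (biproduct.lift fun i => biproduct.π X i.succ), ?_, ?_⟩
    · refine biprod.hom_ext' _ _ ?_ (biproduct.hom_ext' _ _ fun i => ?_) <;>
        refine biprod.hom_ext _ _ ?_ (biproduct.hom_ext _ _ fun j => ?_)
      · simp
      · simp [biproduct.ι_π_ne _ (Fin.succ_ne_zero j).symm]
      · simp [biproduct.ι_π_ne _ (Fin.succ_ne_zero i)]
      · by_cases h : i = j
        · subst h; simp
        · have h' : i.succ ≠ j.succ := fun hh => h (Fin.succ_injective _ hh)
          simp [biproduct.ι_π_ne _ h, biproduct.ι_π_ne _ h']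
    · refine biproduct.hom_ext' _ _ fun i => ?_
      refine Fin.cases ?_ (fun i => ?_) i
      · have : biproduct.ι X 0 ≫ biproduct.lift (fun i : Fin n => biproduct.π X i.succ) = 0 :=
          biproduct.hom_ext _ _ fun j => by
            simp [biproduct.ι_π_ne _ (Fin.succ_ne_zero j).symm]
        simp [biprod.lift_desc, reassoc_of% this]
      · have : biproduct.ι X i.succ ≫ biproduct.lift (fun i : Fin n => biproduct.π X i.succ) =
            biproduct.ι (fun i : Fin n => X i.succ) i :=
          biproduct.hom_ext _ _ fun j => by
            by_cases h : i = j
            · subst h; simp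
            · have h' : i.succ ≠ j.succ := fun hh => h (Fin.succ_injective _ hh)
              simp [biproduct.ι_π_ne _ h, biproduct.ι_π_ne _ h']
        simp [biprod.lift_desc, reassoc_of% this, biproduct.ι_π_ne_assoc _ (Fin.succ_ne_zero i)]

/-- An object of `Gen G`, where `G` belongs to a wide subcategory, is a quotient of an object of
the wide subcategory. -/
lemma IsWide.exists_epi {A : ObjectProperty C} (hA : IsWide A) {G : C} (hG : A G) {X : C}
    (hX : Gen G X) : ∃ (Y : C) (p : Y ⟶ X), A Y ∧ Epi p := by
  obtain ⟨n, p, hp⟩ := hX.exists_epi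
  exact ⟨_, p, hA.prop_biproduct _ fun _ => hG, hp⟩

/-- A wide subcategory is recovered from the torsion class which it generates. -/
lemma IsWide.wideOf_gen (k : Type*) [Field k] [Linear k C] [∀ X Y : C, Module.Finite k (X ⟶ Y)]
    {A : ObjectProperty C} (hA : IsWide A) {G : C} (hG : A G)
    (hAG : A ≤ Gen G) : wideOf (Gen G) = A := by
  have := hA.closedUnderKernels
  have := hA.closedUnderCokernels
  ext B
  constructor
  · rintro ⟨hB, hker⟩
    obtain ⟨A₁, p, hA₁, hp⟩ := hA.exists_epi hG hB
    obtain ⟨A₂, q, hA₂, hq⟩ := hA.exists_epi hG (hker _ p (hAG _ hA₁))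
    have hc := A.prop_cokernel (q ≫ kernel.ι p) hA₂ hA₁
    refine hA.prop_of_iso (cokernelEpiComp q (kernel.ι p) ≪≫ ?_) hc
    exact (kernel_shortExact p).gIsCokernel.coconePointUniqueUpToIso
      (cokernelIsCokernel (kernel.ι p)) |>.symm
  · refine fun hB => ⟨hAG _ hB, fun Y g hY => ?_⟩
    obtain ⟨A₁, p, hA₁, hp⟩ := hA.exists_epi hG hY
    have hK := hAG _ (A.prop_kernel (p ≫ g) hA₁ hB)
    -- The kernel of `p ≫ g` is the pullback of `kernel.ι g` along `p`, so it covers `kernel g`.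
    refine gen_of_jointly_epi k fun W h hh => ?_
    have hpb : IsPullback (kernel.ι (p ≫ g)) (kernel.lift g (kernel.ι (p ≫ g) ≫ p) (by simp))
        p (kernel.ι g) :=
      { w := by simp
        isLimit' := ⟨PullbackCone.IsLimit.mk _
          (fun s => kernel.lift (p ≫ g) s.fst (by rw [s.condition_assoc]; simp))
          (fun s => by simp)
          (fun s => by rw [← cancel_mono (kernel.ι g)]; simp [s.condition])
          (fun s m h₁ _ => by rw [← cancel_mono (kernel.ι (p ≫ g))]; simp [h₁])⟩ }
    have : Epi (kernel.lift g (kernel.ι (p ≫ g) ≫ p) (by simp)) :=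
      Abelian.epi_snd_of_isLimit p (kernel.ι g) hpb.isLimit
    exact (hK.of_epi (kernel.lift g (kernel.ι (p ≫ g) ≫ p) _)).eq_zero h hh

/-- In a hereditary category, `Gen G` is closed under extensions when `G` generates a wide
subcategory. For an extension `Y` of `Z` by `X`, and objects `A₁`, `A₂` of the subcategory
covering `X` and `Z`, the class of `Y` restricted to `A₂` lifts to an extension of `A₂` by `A₁`,
and the latter maps to `Y`. -/
lemma IsWide.gen_closedUnderExtensions (k : Type*) [Field k] [Linear k C]
    [∀ X Y : C, Module.Finite k (X ⟶ Y)] [HasExt.{w} C] [EnoughProjectives C]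
    (hext : ∀ X Y : C, Subsingleton (Ext X Y 2)) {A : ObjectProperty C} (hA : IsWide A) {G : C}
    (hG : A G) (hAG : A ≤ Gen G) : (Gen G).IsClosedUnderExtensions := by
  refine ⟨fun {S} hS hX hZ => gen_of_jointly_epi k fun W h hh => ?_⟩
  obtain ⟨A₁, q, hA₁, hq⟩ := hA.exists_epi hG hX
  obtain ⟨A₂, a, hA₂, ha⟩ := hA.exists_epi hG hZ
  obtain ⟨ξ, hξ⟩ := Ext.covariant_sequence_exact₃ A₂ (kernel_shortExact q)
    ((Ext.mk₀ a).comp hS.extClass (zero_add 1)) (one_add_one_eq_two) (Subsingleton.elim _ _)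
  obtain ⟨E, f, g, z, hE, rfl⟩ := exists_shortExact_extClass_eq ξ
  have hEA : A E := by
    have := hA.closedUnderExtensions
    exact A.prop_X₂_of_shortExact hE hA₁ hA₂
  obtain ⟨l, hl⟩ := Ext.covariant_sequence_exact₃ E hS (Ext.mk₀ (g ≫ a)) (zero_add 1) (by
    rw [← Ext.mk₀_comp_mk₀, Ext.comp_assoc (a₁₂ := 0) (a₂₃ := 1) _ _ _ (by lia) (by lia) (by lia),
      ← hξ, ← Ext.comp_assoc (a₁₂ := 1) _ _ _ (by lia) (by lia) (by lia)]
    erw [hE.comp_extClass]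
    rw [Ext.zero_comp])
  obtain ⟨l, rfl⟩ := (Ext.mk₀_bijective _ _).2 l
  rw [Ext.mk₀_comp_mk₀] at hl
  have hl' : l ≫ S.g = g ≫ a := (Ext.mk₀_bijective _ _).1 hl
  have hkill : ∀ {Y : C} (m : Y ⟶ S.X₂), A Y → m ≫ h = 0 := fun m hY =>
    (hAG _ hY).eq_zero _ fun t => by rw [← Category.assoc, hh]
  have hf : S.f ≫ h = 0 := by
    rw [← cancel_epi q, comp_zero, ← Category.assoc]
    exact hkill _ hA₁
  have hm : S.g ≫ hS.gIsCokernel.desc (CokernelCofork.ofπ h hf) = h :=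
    hS.gIsCokernel.fac (CokernelCofork.ofπ h hf) WalkingParallelPair.one
  have := hE.epi_g
  have hg : Epi g := this
  rw [← hm]
  have h0 : hS.gIsCokernel.desc (CokernelCofork.ofπ h hf) = 0 := by
    rw [← cancel_epi a, ← cancel_epi g, comp_zero, comp_zero, ← Category.assoc, ← hl',
      Category.assoc, hm]
    exact hkill _ hEA
  rw [h0, comp_zero]

/-- If `X` and `H` generate `I`, and `X` is indecomposable, then an epimorphism from `I` to `X`
splits unless `X` is already generated by `H`. -/
lemma isSplitEpi_or_gen (k : Type*) [Field k] [Linear k C] [∀ X Y : C, Module.Finite k (X ⟶ Y)]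
    {X H I : C} (hX : Indecomposable X) (p : I ⟶ X) [Epi p]
    (hI : ∀ (W : C) (h : I ⟶ W), (∀ f : X ⟶ I, f ≫ h = 0) → (∀ f : H ⟶ I, f ≫ h = 0) → h = 0) :
    IsSplitEpi p ∨ Gen H X := by
  by_cases hs : ∃ f : X ⟶ I, IsIso (f ≫ p)
  · obtain ⟨f, hf⟩ := hs
    exact Or.inl (isSplitEpi_of_comp_isIso f p)
  refine Or.inr (gen_of_jointly_epi k fun W h₀ hh₀ => ?_)
  by_contra hne
  -- Among the nonzero morphisms killing all images of `H`, take one whose orbit under the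
  -- endomorphisms of `X` spans a subspace of least dimension.
  let V : Set (X ⟶ W) := {h | h ≠ 0 ∧ ∀ f : H ⟶ X, f ≫ h = 0}
  let D : (X ⟶ W) → ℕ := fun h => Module.finrank k (LinearMap.range (Linear.rightComp k X h))
  have hV : V.Nonempty := ⟨h₀, hne, hh₀⟩
  let h := Function.argminOn D V hV
  obtain ⟨hn, hH⟩ : h ∈ V := Function.argminOn_mem D V hV
  obtain ⟨f, hf⟩ : ∃ f : X ⟶ I, (f ≫ p) ≫ h ≠ 0 := by
    by_contra! hcon
    apply hn
    rw [← cancel_epi p, comp_zero]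
    exact hI _ _ (fun f => by rw [← Category.assoc, hcon]) fun f => by rw [← Category.assoc, hH]
  have hmem : (f ≫ p) ≫ h ∈ V := ⟨hf, fun g => by rw [← Category.assoc, hH]⟩
  have hle : LinearMap.range (Linear.rightComp k X ((f ≫ p) ≫ h)) ≤
      LinearMap.range (Linear.rightComp k X h) := by
    rintro _ ⟨e, rfl⟩
    exact ⟨e ≫ f ≫ p, by simp⟩
  have heq := Submodule.eq_of_le_of_finrank_le hle (Function.argminOn_le D V hmem)
  obtain ⟨e, he⟩ : h ∈ LinearMap.range (Linear.rightComp k X ((f ≫ p) ≫ h)) :=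
    heq ▸ ⟨𝟙 X, by simp⟩
  refine hs ⟨e ≫ f, isIso_of_comp_eq_self k hX hn (u := (e ≫ f) ≫ p) ?_⟩
  simpa using he

/-- A finitely generated wide subcategory is generated by finitely many of its objects, each split
projective in the torsion class: the members of a generating family of least length. -/
lemma IsFinitelyGenerated.exists_splitProjective (k : Type*) [Field k] [Linear k C]
    [∀ X Y : C, Module.Finite k (X ⟶ Y)] {A : ObjectProperty C}
    (hA : IsFinitelyGenerated A) : ∃ (n : ℕ) (G : Fin n → C), (∀ i, A (G i)) ∧ A ≤ Gen (⨁ G) ∧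
      ∀ i, IsSplitProjective (Gen (⨁ G)) (G i) := by
  classical
  unfold IsFinitelyGenerated at hA
  obtain ⟨G, hind, hGA, hgen⟩ := Nat.find_spec hA
  have hmin := fun {m} => Nat.find_min (m := m) hA
  generalize Nat.find hA = n at G hmin
  refine ⟨n, G, hGA, hgen, fun i => ⟨gen_biproduct G i, fun I p hI hp => ?_⟩⟩
  obtain _ | n := n
  · exact i.elim0
  have : ∀ j : Fin (n + 1), j = i ∨ Gen (⨁ fun j => G (i.succAbove j)) (G j) := by
    intro j
    rcases eq_or_ne j i with h | h
    · exact Or.inl h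
    · obtain ⟨l, rfl⟩ := Fin.exists_succAbove_eq h
      exact Or.inr (gen_biproduct (fun j => G (i.succAbove j)) l)
  refine (isSplitEpi_or_gen k (H := ⨁ fun j => G (i.succAbove j)) (hind i) p
    fun W h h₁ h₂ => ?_).resolve_right fun hi => ?_
  · refine hI.eq_zero_of_biproduct h fun j f => ?_
    rcases this j with rfl | hj
    · exact h₁ f
    · exact hj.eq_zero _ fun g => by rw [← Category.assoc, h₂]
  · refine hmin (Nat.lt_succ_self n) ⟨fun j => G (i.succAbove j), fun j => hind _,
      fun j => hGA _, fun X hX => gen_of_jointly_epi k fun W h hh => ?_⟩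
    refine (hgen X hX).eq_zero_of_biproduct h fun j f => ?_
    rcases this j with rfl | hj
    · exact hi.eq_zero _ fun g => by rw [← Category.assoc, hh]
    · exact hj.eq_zero _ fun g => by rw [← Category.assoc, hh]

end Wide

section Completion

variable {C : Type*} [Category C] [Abelian C]

/-! ### Completing an Ext-projective generator to a tilting object -/

/-- An Ext-projective generator `G` of the torsion class `Gen G` extends to an object `T` which
also detects membership in `Gen G` by the vanishing of `Ext¹(T, -)`. It is the sum of `G` and the
cokernel of a left `add G`-approximation `f` of a projective generator `P`. The kernel `K` of `f` is
projective by heredity and has no nonzero morphisms to `T`; this makes it invisible to the objects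
`M` supported on `T`, so that morphisms from `P` to such objects factor through the image
of `f`. -/
lemma exists_extProjective_completion (k : Type*) [Field k] [Linear k C]
    [∀ X Y : C, Module.Finite k (X ⟶ Y)] [HasExt.{w} C]
    (hext : ∀ X Y : C, Subsingleton (Ext X Y 2)) {P : C} [Projective P]
    (hP : ∀ F : C, (∀ f : P ⟶ F, f = 0) → IsZero F) {G : C}
    (hG : ∀ X, Gen G X → Subsingleton (Ext G X 1)) :
    ∃ T : C, Gen T = Gen G ∧ (∀ X, Gen G X → Subsingleton (Ext T X 1)) ∧
      ∀ M : C, (∀ K : C, Projective K → (∀ f : K ⟶ T, f = 0) → ∀ f : K ⟶ M, f = 0) →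
        Subsingleton (Ext T M 1) → Gen T M := by
  let b := Module.finBasis k (P ⟶ G)
  let f : P ⟶ ⨁ fun _ : Fin (Module.finrank k (P ⟶ G)) => G := biproduct.lift b
  -- Every morphism from `P` to `G` factors through `f`.
  have hf : ∀ g : P ⟶ G, ∃ h, f ≫ h = g := by
    intro g
    refine ⟨biproduct.desc fun i => b.repr g i • 𝟙 G, ?_⟩
    rw [biproduct.lift_desc]
    simp [b.sum_repr]
  have hGn : ∀ X, Gen G X → Subsingleton
      (Ext (⨁ fun _ : Fin (Module.finrank k (P ⟶ G)) => G) X 1) := fun X hX =>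
    ext_biproduct_left fun _ => hG X hX
  have hS₁ := kernel_shortExact (Abelian.factorThruImage f)
  have hS₂ : (ShortComplex.mk (Abelian.image.ι f) (cokernel.π f) (kernel.condition _)).ShortExact :=
    { exact := ShortComplex.exact_kernel _ }
  have hGT : Gen G (cokernel f) := (Gen.of_epi_biproduct (𝟙 _)).of_epi (cokernel.π f)
  have hText : ∀ X, Gen G X → Subsingleton (Ext (cokernel f) X 1) := by
    refine fun X hX => ext_X₃_left_of_extend hS₂ (fun g => ?_) (hGn X hX)
    obtain ⟨n, q, hq⟩ := hX.exists_epi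
    let g' := Abelian.factorThruImage f ≫ g
    choose h hh using fun i => hf (Projective.factorThru g' q ≫ biproduct.π _ i)
    refine ⟨biproduct.lift h ≫ q, ?_⟩
    have h1 : f ≫ biproduct.lift h = Projective.factorThru g' q :=
      biproduct.hom_ext _ _ fun i => by simp [hh]
    rw [← cancel_epi (Abelian.factorThruImage f), ← Category.assoc]
    change _ ≫ _ = g'
    rw [Abelian.image.fac, ← Category.assoc, h1, Projective.factorThru_comp]
  let K := kernel (Abelian.factorThruImage f)
  have hKproj : Projective K := projective_iff_subsingleton_ext_one.2 fun {Y} =>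
    ext_X₁_left hS₁ (one_add_one_eq_two) (HasProjectiveDimensionLT.subsingleton P 1 1 le_rfl Y)
      (hext _ _)
  have hKG : ∀ u : K ⟶ G, u = 0 := by
    intro u
    have hJ : Subsingleton (Ext (Abelian.image f) G 1) :=
      ext_X₁_left hS₂ (one_add_one_eq_two) (hGn G (gen_self G)) (hext _ _)
    obtain ⟨g, hg⟩ := exists_extend_of_ext_eq_zero hS₁ hJ u
    obtain ⟨h, hh⟩ := hf g
    change kernel.ι (Abelian.factorThruImage f) ≫ g = u at hg
    have h0 : kernel.ι (Abelian.factorThruImage f) ≫ f = 0 :=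
      (congrArg (kernel.ι (Abelian.factorThruImage f) ≫ ·) (Abelian.image.fac f)).symm.trans
        (by rw [← Category.assoc, kernel.condition, zero_comp])
    rw [← hg, ← hh, ← Category.assoc, h0, zero_comp]
  have hKGen : ∀ X, Gen G X → ∀ u : K ⟶ X, u = 0 := by
    intro X hX u
    obtain ⟨n, q, hq⟩ := hX.exists_epi
    have : Projective.factorThru u q = 0 := biproduct.hom_ext _ _ fun i => by
      rw [hKG (_ ≫ _), zero_comp]
    rw [← Projective.factorThru_comp u q, this, zero_comp]
  have hT : Gen G (G ⊞ cokernel f) := gen_biprod k (gen_self G) hGT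
  have hGen : Gen (G ⊞ cokernel f) = Gen G := by
    ext X
    exact ⟨fun h => hT.of_gen k h, fun h => ((gen_self _).of_epi biprod.fst).of_gen k h⟩
  have hTall : ∀ X, Gen G X → Subsingleton (Ext (G ⊞ cokernel f) X 1) := fun X hX => by
    have := hG X hX
    have := hText X hX
    exact Ext.biprodAddEquiv.toEquiv.subsingleton
  refine ⟨G ⊞ cokernel f, hGen, hTall, fun M hM hME => ?_⟩
  -- The torsion-free quotient `F` of `M` has no morphisms or extensions from `G ⊞ cokernel f`.
  obtain ⟨W, F, i, p, z, hS, hW, hp⟩ := exists_trace k (G ⊞ cokernel f) M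
  have hWE := hTall W (hGen ▸ hW)
  have hTF : ∀ g : G ⊞ cokernel f ⟶ F, g = 0 := fun g => by
    obtain ⟨g', rfl⟩ := exists_lift_of_ext_eq_zero hS hWE g
    exact hp g'
  have hTFE : Subsingleton (Ext (G ⊞ cokernel f) F 1) := ext_X₃_right hS rfl (hext _ _) hME
  -- A morphism `P ⟶ F` kills `K`, extends along the image of `f` to the sum of copies of `G`, and
  -- vanishes there.
  have hF : IsZero F := by
    refine hP F fun g => ?_
    have : Epi p := hS.epi_g
    have h0 : kernel.ι (Abelian.factorThruImage f) ≫ g = 0 := by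
      rw [← Projective.factorThru_comp (kernel.ι (Abelian.factorThruImage f) ≫ g) p,
        hM K hKproj (hKGen _ hT) (Projective.factorThru (P := K) _ p), zero_comp]
    have hm : Abelian.factorThruImage f ≫ hS₁.gIsCokernel.desc (CokernelCofork.ofπ g h0) = g :=
      hS₁.gIsCokernel.fac (CokernelCofork.ofπ g h0) WalkingParallelPair.one
    obtain ⟨g', hg'⟩ := exists_extend_of_ext_eq_zero hS₂
      (ext_retract_left ⟨biprod.inr, biprod.snd, biprod.inr_snd⟩ hTFE)
      (hS₁.gIsCokernel.desc (CokernelCofork.ofπ g h0))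
    have : g' = 0 := biproduct.hom_ext' _ _ fun i => by
      have := congrArg (biprod.inl ≫ ·) (hTF (biprod.fst ≫ biproduct.ι (fun _ => G) i ≫ g'))
      simpa using this
    rw [← hm, ← hg', this, comp_zero, comp_zero]
  refine gen_of_jointly_epi k fun W' h hh => ?_
  have : Epi i := (hS.exact.epi_f (hF.eq_of_tgt _ _))
  rw [← cancel_epi i, comp_zero]
  exact hW.eq_zero _ fun t => by rw [← Category.assoc, hh]

end Completion

/-! ### Stability for the torsion class of a tilting object -/

section Stability

variable {C : Type*} [Category C] [Abelian C]

/-- The situation in which stability is compared with `𝔞`: `Gen (⨁ T)` consists of the objects `M`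
of a Serre class `S` (the objects supported on `⨁ T`) with `Ext¹(T i, M) = 0` for all `i`. -/
structure IsTiltingFamily [HasExt.{w} C] {ι : Type*} [Finite ι] (S : ObjectProperty C)
    (T : ι → C) : Prop where
  serre : S.IsSerreClass
  gen_le : Gen (⨁ T) ≤ S
  ext_gen : ∀ i X, Gen (⨁ T) X → Subsingleton (Ext (T i) X 1)
  gen_of_ext : ∀ X, S X → (∀ i, Subsingleton (Ext (T i) X 1)) → Gen (⨁ T) X

namespace IsTiltingFamily

variable [HasExt.{w} C] {ι : Type*} [Finite ι] {S : ObjectProperty C} {T : ι → C}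

lemma gen_extension (hT : IsTiltingFamily S T) {Z : ShortComplex C} (hZ : Z.ShortExact)
    (h₁ : Gen (⨁ T) Z.X₁) (h₃ : Gen (⨁ T) Z.X₃) : Gen (⨁ T) Z.X₂ := by
  have := hT.serre
  exact hT.gen_of_ext _ (S.prop_X₂_of_shortExact hZ (hT.gen_le _ h₁) (hT.gen_le _ h₃))
    fun i => ext_X₂_right hZ (hT.ext_gen i _ h₁) (hT.ext_gen i _ h₃)

/-- An object of the support class on which `Ext¹(T i, -)` vanishes for every `T i` that is not
split projective lies in the torsion class. A nonzero class in some `Ext¹(T i, X)` gives an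
extension `E` of `T i` by `X` with smaller total `Ext¹`; by induction `E` lies in the torsion class,
hence `E ⟶ T i` splits and `X` is a quotient of `E`. -/
lemma gen_of_ext_nonsplit (k : Type*) [Field k] [Linear k C] [EnoughProjectives C]
    [∀ X Y : C, Module.Finite k (Ext X Y 1)] (hT : IsTiltingFamily S T) {X : C} (hX : S X)
    (h : ∀ i, ¬ IsSplitProjective (Gen (⨁ T)) (T i) → Subsingleton (Ext (T i) X 1)) :
    Gen (⨁ T) X := by
  have := Fintype.ofFinite ι
  have := hT.serre
  induction hn : ∑ i, Module.finrank k (Ext (T i) X 1) using Nat.strong_induction_on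
    generalizing X with
  | _ n ih =>
  by_cases hall : ∀ i, Subsingleton (Ext (T i) X 1)
  · exact hT.gen_of_ext X hX hall
  push Not at hall
  obtain ⟨i, hi⟩ := hall
  obtain ⟨ξ, hξ⟩ := exists_ne (0 : Ext (T i) X 1)
  have hsplit : IsSplitProjective (Gen (⨁ T)) (T i) := by
    by_contra hns
    have := h i hns
    exact hξ (Subsingleton.elim _ _)
  obtain ⟨E, f, g, z, hE, rfl⟩ := exists_shortExact_extClass_eq ξ
  have hTi : ∀ j, Subsingleton (Ext (T j) (T i) 1) := fun j => hT.ext_gen j _ (gen_biproduct T i)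
  let φ : ∀ j, Ext (T j) X 1 →ₗ[k] Ext (T j) E 1 := fun j =>
    (Ext.mk₀ f).postcompOfLinear k (T j) (add_zero 1)
  have hφ : ∀ j, Function.Surjective (φ j) := fun j y => by
    have := hTi j
    exact Ext.covariant_sequence_exact₂ (T j) hE y (Subsingleton.elim _ _)
  have hE𝒯 : Gen (⨁ T) E := by
    refine ih (∑ j, Module.finrank k (Ext (T j) E 1)) ?_ ?_ ?_ rfl
    · rw [← hn]
      refine Finset.sum_lt_sum (fun j _ => LinearMap.finrank_le_finrank_of_surjective (hφ j))
        ⟨i, Finset.mem_univ i, ?_⟩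
      have h1 := (φ i).finrank_range_add_finrank_ker
      rw [LinearMap.range_eq_top.2 (hφ i), finrank_top] at h1
      have h2 : 0 < Module.finrank k (LinearMap.ker (φ i)) := by
        refine Module.finrank_pos_iff_exists_ne_zero.2 ⟨⟨hE.extClass, hE.extClass_comp⟩, ?_⟩
        exact fun h0 => hξ (congrArg Subtype.val h0)
      lia
    · exact S.prop_X₂_of_shortExact hE hX (hT.gen_le _ (gen_biproduct T i))
    · exact fun j hj => ext_X₂_right hE (h j hj) (hTi j)
  have hg : Epi g := hE.epi_g
  have hf : Mono f := hE.mono_f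
  obtain ⟨⟨s⟩⟩ := hsplit.2 E g hE𝒯 hg
  let σ := ShortComplex.Splitting.ofExactOfSection _ hE.exact s.section_ s.id hf
  have : IsSplitEpi σ.r := ⟨⟨⟨f, σ.f_r⟩⟩⟩
  exact hE𝒯.of_epi σ.r

/-- The canonical sequence of an object with respect to the torsion pair of `Gen (⨁ T)`. -/
lemma exists_torsion (k : Type*) [Field k] [Linear k C] [∀ X Y : C, Module.Finite k (X ⟶ Y)]
    (hT : IsTiltingFamily S T) (V : C) : ∃ (W F : C) (i : W ⟶ V) (p : V ⟶ F) (z : i ≫ p = 0),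
      (ShortComplex.mk i p z).ShortExact ∧ Gen (⨁ T) W ∧ ∀ j (f : T j ⟶ F), f = 0 := by
  obtain ⟨W, F, i, p, z, hS, hW, hp⟩ := exists_trace k (⨁ T) V
  refine ⟨W, F, i, p, z, hS, hW, fun j f => ?_⟩
  obtain ⟨g, rfl⟩ := exists_lift_of_ext_eq_zero hS (hT.ext_gen j W hW) f
  rw [← cancel_epi (biproduct.π T j), comp_zero]
  exact (Category.assoc _ _ _).symm.trans (hp _)

/-- An object of `𝔞(Gen (⨁ T))` receives no nonzero morphism from a summand `T i` which is not
split projective. Let `p : I ⟶ T i` be an epimorphism in the torsion class and let `h : T i ⟶ B`.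
The kernel of `p ≫ h` lies in the torsion class, so there is `s : T i ⟶ I` with
`s ≫ p ≫ h = h`. If `h` is nonzero, then `s ≫ p` is invertible by Fitting's lemma,
and `p` splits. -/
lemma hom_eq_zero_of_wideOf (k : Type*) [Field k] [Linear k C]
    [∀ X Y : C, Module.Finite k (X ⟶ Y)] (hT : IsTiltingFamily S T)
    {i : ι} (hind : Indecomposable (T i))
    (hi : ¬ IsSplitProjective (Gen (⨁ T)) (T i)) {B : C} (hB : wideOf (Gen (⨁ T)) B)
    (h : T i ⟶ B) : h = 0 := by
  by_contra h0
  refine hi ⟨gen_biproduct T i, fun I p hI hp => ?_⟩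
  have hK := hB.2 I (p ≫ h) hI
  let q := Abelian.factorThruImage (p ≫ h)
  have hS : (ShortComplex.mk (kernel.ι (p ≫ h)) q (by
      rw [← cancel_mono (Abelian.image.ι (p ≫ h))]; simp [q])).ShortExact := by
    refine { exact := ?_ }
    refine ShortComplex.exact_of_f_is_kernel _ (KernelFork.IsLimit.ofι' _ _ fun t ht => ?_)
    refine ⟨kernel.lift _ t ?_, kernel.lift_ι _ _ _⟩
    rw [← Abelian.image.fac (p ≫ h), ← Category.assoc]
    change (t ≫ q) ≫ _ = 0
    rw [ht, zero_comp]
  -- `h` factors through the image of `p ≫ h` because `p` is an epimorphism.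
  have hc : h ≫ cokernel.π (p ≫ h) = 0 := by
    rw [← cancel_epi p, ← Category.assoc, cokernel.condition, comp_zero]
  obtain ⟨s, hs⟩ := exists_lift_of_ext_eq_zero hS (hT.ext_gen i _ hK)
    (kernel.lift (cokernel.π (p ≫ h)) h hc)
  have hs' : (s ≫ p) ≫ h = h := by
    have := congrArg (· ≫ Abelian.image.ι (p ≫ h)) hs
    simp only [Category.assoc] at this
    erw [Abelian.image.fac, kernel.lift_ι] at this
    rw [Category.assoc, this]
  have := isIso_of_comp_eq_self k hind h0 hs'
  exact isSplitEpi_of_comp_isIso s p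

/-- The numerical form of the comparison of `𝔞` with semistability: the function `θ` is additive,
is nonnegative on torsion objects and nonpositive on torsion-free ones, and its vanishing there is
the vanishing of the terms of its defining sum. The function `β` measures the dimension outside of
the support class. -/
lemma wideOf_iff (k : Type*) [Field k] [Linear k C] [EnoughProjectives C]
    [∀ X Y : C, Module.Finite k (X ⟶ Y)] [∀ X Y : C, Module.Finite k (Ext X Y 1)]
    [Fintype ι] (hT : IsTiltingFamily S T) (hind : ∀ i, Indecomposable (T i))
    {a : ι → ℤ} (ha₀ : ∀ i, IsSplitProjective (Gen (⨁ T)) (T i) → a i = 0)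
    (ha₁ : ∀ i, ¬ IsSplitProjective (Gen (⨁ T)) (T i) → 0 < a i)
    {β θ : C → ℤ} (hβ : ∀ X, β X ≤ 0) (hβS : ∀ X, β X = 0 ↔ S X)
    (hθ : ∀ X, θ X = ∑ i, a i * ((Module.finrank k (T i ⟶ X) : ℤ) -
      (Module.finrank k (Ext (T i) X 1) : ℤ)) + β X)
    (hadd : ∀ Z : ShortComplex C, Z.ShortExact → θ Z.X₂ = θ Z.X₁ + θ Z.X₃) (B : C) :
    wideOf (Gen (⨁ T)) B ↔ θ B = 0 ∧ ∀ (W : C) (i : W ⟶ B), Mono i → θ W ≤ 0 := by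
  have := hT.serre
  have ha : ∀ i, 0 ≤ a i := fun i => by
    by_cases h : IsSplitProjective (Gen (⨁ T)) (T i)
    · rw [ha₀ i h]
    · exact (ha₁ i h).le
  have hθtors : ∀ X, Gen (⨁ T) X → θ X = ∑ i, a i * (Module.finrank k (T i ⟶ X) : ℤ) := by
    intro X hX
    rw [hθ, (hβS X).2 (hT.gen_le X hX), add_zero]
    refine Finset.sum_congr rfl fun i _ => ?_
    have := hT.ext_gen i X hX
    rw [Module.finrank_zero_of_subsingleton (M := Ext (T i) X 1), Nat.cast_zero, sub_zero]
  have hnonneg : ∀ X, Gen (⨁ T) X → 0 ≤ θ X := fun X hX => by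
    rw [hθtors X hX]
    exact Finset.sum_nonneg fun i _ => mul_nonneg (ha i) (Nat.cast_nonneg _)
  have hzero : ∀ X, Gen (⨁ T) X → θ X = 0 → ∀ i,
      ¬ IsSplitProjective (Gen (⨁ T)) (T i) → ∀ f : T i ⟶ X, f = 0 := by
    intro X hX h0 i hi f
    rw [hθtors X hX, Finset.sum_eq_zero_iff_of_nonneg
      fun i _ => mul_nonneg (ha i) (Nat.cast_nonneg _)] at h0
    have h1 := (mul_eq_zero.1 (h0 i (Finset.mem_univ i))).resolve_left (ha₁ i hi).ne'
    have := Module.finrank_zero_iff.1 (Nat.cast_eq_zero.1 h1)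
    exact Subsingleton.elim _ _
  have hzero' : ∀ X, Gen (⨁ T) X → (∀ i, ¬ IsSplitProjective (Gen (⨁ T)) (T i) →
      ∀ f : T i ⟶ X, f = 0) → θ X = 0 := by
    intro X hX h0
    rw [hθtors X hX]
    refine Finset.sum_eq_zero fun i _ => ?_
    by_cases hi : IsSplitProjective (Gen (⨁ T)) (T i)
    · rw [ha₀ i hi, zero_mul]
    · have : Subsingleton (T i ⟶ X) := subsingleton_of_forall_eq 0 (h0 i hi)
      rw [Module.finrank_zero_of_subsingleton, Nat.cast_zero, mul_zero]
  have hθfree : ∀ F, (∀ j (f : T j ⟶ F), f = 0) →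
      θ F = ∑ i, -(a i * (Module.finrank k (Ext (T i) F 1) : ℤ)) + β F := by
    intro F hF
    rw [hθ]
    congr 1
    refine Finset.sum_congr rfl fun i _ => ?_
    have : Subsingleton (T i ⟶ F) := subsingleton_of_forall_eq 0 (hF i)
    rw [Module.finrank_zero_of_subsingleton (M := T i ⟶ F), Nat.cast_zero, zero_sub, mul_neg]
  have hterm : ∀ F i, -(a i * (Module.finrank k (Ext (T i) F 1) : ℤ)) ≤ 0 := fun F i =>
    neg_nonpos.2 (mul_nonneg (ha i) (Nat.cast_nonneg _))
  constructor
  · intro hB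
    have hhom := fun i hi => hT.hom_eq_zero_of_wideOf k (hind i) hi hB
    refine ⟨hzero' B hB.1 hhom, fun W i hi => ?_⟩
    obtain ⟨W', F, j, p, z, hS, hW', hF⟩ := hT.exists_torsion k W
    have hj : Mono j := hS.mono_f
    have h1 : θ W' = 0 := hzero' W' hW' fun l hl f => by
      rw [← cancel_mono (j ≫ i), zero_comp]
      exact hhom l hl _
    have h2 : θ F ≤ 0 := by
      rw [hθfree F hF]
      exact add_nonpos (Finset.sum_nonpos fun i _ => hterm F i) (hβ F)
    have := hadd _ hS
    dsimp only at this
    lia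
  · rintro ⟨hB0, hB⟩
    -- A semistable object is torsion: its torsion-free quotient `F` lies in the torsion class.
    have hBgen : Gen (⨁ T) B := by
      obtain ⟨W, F, j, p, z, hS, hW, hF⟩ := hT.exists_torsion k B
      have hW0 := hnonneg W hW
      have hW1 := hB W j hS.mono_f
      have h1 : θ F = 0 := by
        have := hadd _ hS
        dsimp only at this
        lia
      rw [hθfree F hF] at h1
      have hsum := Finset.sum_nonpos fun i (_ : i ∈ Finset.univ) => hterm F i
      have hβF := hβ F
      have hSF : S F := (hβS F).1 (by lia)
      have hsum0 : ∑ i, -(a i * (Module.finrank k (Ext (T i) F 1) : ℤ)) = 0 := by lia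
      rw [Finset.sum_eq_zero_iff_of_nonpos fun i _ => hterm F i] at hsum0
      have hFgen : Gen (⨁ T) F := hT.gen_of_ext_nonsplit k hSF fun i hi => by
        have h2 := (mul_eq_zero.1 (neg_eq_zero.1 (hsum0 i (Finset.mem_univ i)))).resolve_left
          (ha₁ i hi).ne'
        exact Module.finrank_zero_iff.1 (Nat.cast_eq_zero.1 h2)
      exact hT.gen_extension hS hW hFgen
    refine ⟨hBgen, fun Y g hY => ?_⟩
    -- The image `I` of `g` is torsion with `θ I = 0`, which controls `Ext¹(T i, ker g)`.
    have hI : Gen (⨁ T) (Abelian.image g) := hY.of_epi (Abelian.factorThruImage g)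
    have hI0 : θ (Abelian.image g) = 0 :=
      le_antisymm (hB _ (Abelian.image.ι g) inferInstance) (hnonneg _ hI)
    have hS := kernel_shortExact (Abelian.factorThruImage g)
    have hK : Gen (⨁ T) (kernel (Abelian.factorThruImage g)) :=
      hT.gen_of_ext_nonsplit k (S.prop_X₁_of_shortExact hS (hT.gen_le _ hY)) fun i hi =>
        ext_X₁_right_of_hom hS (hzero _ hI hI0 i hi) (hT.ext_gen i _ hY)
    have e : kernel (Abelian.factorThruImage g) ≅ kernel g :=
      (kernelCompMono (Abelian.factorThruImage g) (Abelian.image.ι g)).symm ≪≫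
        kernelIsoOfEq (Abelian.image.fac g)
    exact hK.of_epi e.hom

end IsTiltingFamily

end Stability

/-! ### Representations as families of vector spaces -/

section Elements

variable {k : Type u} [Field k] {Q : Type v} [Quiver.{w} Q]

/-- The action of a path on a representation, as a linear map. -/
def act (M : Rep k Q) {x y : Q} (p : Quiver.Path x y) : M.obj x →ₗ[k] M.obj y :=
  (M.map p).hom.hom

/-- The component of a morphism of representations at a vertex, as a linear map. -/
def appLin {M N : Rep k Q} (f : M ⟶ N) (x : Q) : M.obj x →ₗ[k] N.obj x :=
  (f.app x).hom.hom

lemma act_nil (M : Rep k Q) (x : Q) (m : M.obj x) :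
    act M (Quiver.Path.nil : Quiver.Path x x) m = m :=
  LinearMap.congr_fun (congrArg (fun t => t.hom.hom) (M.map_id x)) m

lemma act_comp (M : Rep k Q) {x y z : Q} (p : Quiver.Path x y) (q : Quiver.Path y z) (m : M.obj x) :
    act M (p.comp q) m = act M q (act M p m) :=
  LinearMap.congr_fun (congrArg (fun t => t.hom.hom) (M.map_comp (X := x) (Y := y) (Z := z) p q)) m

lemma appLin_act {M N : Rep k Q} (f : M ⟶ N) {x y : Q} (p : Quiver.Path x y) (m : M.obj x) :
    appLin f y (act M p m) = act N p (appLin f x m) :=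
  LinearMap.congr_fun (congrArg (fun t => t.hom.hom) (f.naturality (X := x) (Y := y) p)) m

lemma appLin_comp {M N L : Rep k Q} (f : M ⟶ N) (g : N ⟶ L) (x : Q) (m : M.obj x) :
    appLin (f ≫ g) x m = appLin g x (appLin f x m) := rfl

lemma appLin_zero (M N : Rep k Q) (x : Q) (m : M.obj x) : appLin (0 : M ⟶ N) x m = 0 := rfl

lemma appLin_id (M : Rep k Q) (x : Q) (m : M.obj x) : appLin (𝟙 M) x m = m := rfl

lemma hom_ext_appLin {M N : Rep k Q} {f g : M ⟶ N} (h : ∀ x m, appLin f x m = appLin g x m) :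
    f = g :=
  NatTrans.ext (funext fun x => FGModuleCat.hom_ext (LinearMap.ext fun m => h x m))

/-- A morphism of representations from linear maps which commute with the arrows. -/
def homMk {M N : Rep k Q} (φ : ∀ x : Q, M.obj x →ₗ[k] N.obj x)
    (hφ : ∀ {x y : Q} (a : x ⟶ y) (m : M.obj x),
      φ y (act M a.toPath m) = act N a.toPath (φ x m)) : M ⟶ N where
  app x := FGModuleCat.ofHom (φ x)
  naturality x y p := by
    have key : ∀ {y : Q} (p : Quiver.Path (show Q from x) y) (m : M.obj x),
        φ y (act M p m) = act N p (φ x m) := by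
      intro y p
      induction p with
      | nil => intro m; rw [act_nil, act_nil]
      | cons p a ih =>
        intro m
        rw [← Quiver.Path.comp_toPath_eq_cons, act_comp, act_comp, hφ, ih]
    exact FGModuleCat.hom_ext (LinearMap.ext fun m => key p m)

lemma appLin_surjective {M N : Rep k Q} (f : M ⟶ N) [Epi f] (x : Q) :
    Function.Surjective (appLin f x) := by
  have h : ∀ y : Paths Q, Epi (f.app y) := fun y => inferInstance
  have := h x
  exact (ModuleCat.epi_iff_surjective _).1
    ((forget₂ (FGModuleCat.{u} k) (ModuleCat.{u} k)).map_epi (f.app x))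

lemma epi_of_surjective {M N : Rep k Q} (f : M ⟶ N) (h : ∀ x, Function.Surjective (appLin f x)) :
    Epi f := by
  refine Preadditive.epi_of_cancel_zero _ fun {L} g hg => hom_ext_appLin fun x n => ?_
  obtain ⟨m, rfl⟩ := h x n
  rw [← appLin_comp, hg, appLin_zero, appLin_zero]

lemma mono_of_injective {M N : Rep k Q} (f : M ⟶ N) (h : ∀ x, Function.Injective (appLin f x)) :
    Mono f := by
  refine Preadditive.mono_of_cancel_zero _ fun {L} g hg => hom_ext_appLin fun x n => h x ?_
  rw [← appLin_comp, hg, appLin_zero, appLin_zero, map_zero]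

lemma finrank_shortExact {S : ShortComplex (Rep k Q)} (hS : S.ShortExact) (x : Paths Q) :
    Module.finrank k (S.X₂.obj x) =
      Module.finrank k (S.X₁.obj x) + Module.finrank k (S.X₃.obj x) := by
  have := hS.mono_f
  have := hS.epi_g
  have h := hS.map ((evaluation (Paths Q) (FGModuleCat.{u} k)).obj x ⋙
    forget₂ (FGModuleCat.{u} k) (ModuleCat.{u} k))
  have hfin : ∀ M : Rep k Q, Module.Finite k (((evaluation (Paths Q) (FGModuleCat.{u} k)).obj x ⋙
    forget₂ (FGModuleCat.{u} k) (ModuleCat.{u} k)).obj M) := fun M => (M.obj x).property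
  have h₁ : Module.Finite k (S.map ((evaluation (Paths Q) (FGModuleCat.{u} k)).obj x ⋙
    forget₂ (FGModuleCat.{u} k) (ModuleCat.{u} k))).X₁ := hfin S.X₁
  have h₃ : Module.Finite k (S.map ((evaluation (Paths Q) (FGModuleCat.{u} k)).obj x ⋙
    forget₂ (FGModuleCat.{u} k) (ModuleCat.{u} k))).X₃ := hfin S.X₃
  exact ModuleCat.free_shortExact_finrank_add h rfl rfl

lemma dimAt_shortExact {S : ShortComplex (Rep k Q)} (hS : S.ShortExact) (x : Q) :
    dimAt S.X₂ x = dimAt S.X₁ x + dimAt S.X₃ x :=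
  finrank_shortExact hS x

lemma isZero_of_dimAt {M : Rep k Q} (h : ∀ x, dimAt M x = 0) : IsZero M := by
  rw [IsZero.iff_id_eq_zero]
  refine hom_ext_appLin fun x m => ?_
  have : Subsingleton (M.obj x) := Module.finrank_zero_iff.1 (h x)
  exact Subsingleton.elim _ _

lemma dimAt_of_isZero {M : Rep k Q} (h : IsZero M) (x : Q) : dimAt M x = 0 := by
  refine Module.finrank_zero_iff.2 (subsingleton_of_forall_eq 0 fun m => ?_)
  rw [← appLin_id M x m, h.eq_of_src (𝟙 M) 0, appLin_zero]

instance [Finite Q] (M N : Rep k Q) : Module.Finite k (M ⟶ N) := by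
  let φ : (M ⟶ N) →ₗ[k] (∀ x : Q, M.obj x →ₗ[k] N.obj x) :=
    { toFun f x := appLin f x
      map_add' _ _ := rfl
      map_smul' _ _ := rfl }
  have : ∀ x : Q, Module.Finite k (M.obj x →ₗ[k] N.obj x) := fun x =>
    Module.Finite.linearMap k k _ _
  have : Module.Finite k (∀ x : Q, M.obj x →ₗ[k] N.obj x) := Module.Finite.pi
  exact Module.Finite.of_injective φ fun f g h =>
    hom_ext_appLin fun x m => LinearMap.congr_fun (congrFun h x) m

end Elements

/-! ### Free representations -/

section Free

variable {Q : Type v} [Quiver.{w} Q]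

lemma wellFounded_path [Finite Q] (hQ : IsAcyclic Q) :
    WellFounded fun x y : Q => ∃ p : Quiver.Path x y, 0 < p.length := by
  have : IsTrans Q fun x y : Q => ∃ p : Quiver.Path x y, 0 < p.length :=
    ⟨fun _ _ _ ⟨p, hp⟩ ⟨q, _⟩ => ⟨p.comp q, by rw [Quiver.Path.length_comp]; lia⟩⟩
  have : Std.Irrefl fun x y : Q => ∃ p : Quiver.Path x y, 0 < p.length :=
    ⟨fun x ⟨p, hp⟩ => hp.ne' (hQ x p)⟩
  exact Finite.wellFounded_of_trans_of_irrefl _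

lemma wellFounded_path_swap [Finite Q] (hQ : IsAcyclic Q) :
    WellFounded fun x y : Q => ∃ p : Quiver.Path y x, 0 < p.length := by
  have : IsTrans Q fun x y : Q => ∃ p : Quiver.Path y x, 0 < p.length :=
    ⟨fun _ _ _ ⟨p, hp⟩ ⟨q, _⟩ => ⟨q.comp p, by rw [Quiver.Path.length_comp]; lia⟩⟩
  have : Std.Irrefl fun x y : Q => ∃ p : Quiver.Path y x, 0 < p.length :=
    ⟨fun x ⟨p, hp⟩ => hp.ne' (hQ x p)⟩
  exact Finite.wellFounded_of_trans_of_irrefl _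

lemma finite_path [Finite Q] [∀ x y : Q, Finite (x ⟶ y)] (hQ : IsAcyclic Q) (x y : Q) :
    Finite (Quiver.Path x y) := by
  induction y using (wellFounded_path hQ).induction with
  | _ y ih =>
  have hfin : ∀ z : Q, Finite (Quiver.Path x z × (z ⟶ y)) := fun z => by
    rcases isEmpty_or_nonempty (z ⟶ y) with h | ⟨⟨a⟩⟩
    · infer_instance
    · have := ih z ⟨a.toPath, by simp⟩
      infer_instance
  let F : PLift (x = y) ⊕ (Σ z : Q, Quiver.Path x z × (z ⟶ y)) → Quiver.Path x y := fun s =>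
    match s with
    | .inl h => h.down ▸ Quiver.Path.nil
    | .inr ⟨_, p, a⟩ => p.cons a
  refine Finite.of_surjective F fun p => ?_
  cases p with
  | nil => exact ⟨.inl ⟨rfl⟩, rfl⟩
  | cons p a => exact ⟨.inr ⟨_, p, a⟩, rfl⟩

variable (k : Type u) [∀ x y : Q, Finite (Quiver.Path x y)]

/-- The paths from some vertex `x i` to `z`, in the universe of the field `k`. -/
abbrev free.Idx (_k : Type u) {I : Type*} [Finite I] (x : I → Q) (z : Q) : Type u :=
  Shrink.{u} (Σ i, Quiver.Path (x i) z)

/-- The index in `free.Idx` of a path starting at `x i`. -/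
noncomputable def free.idx {I : Type*} [Finite I] (x : I → Q) {z : Q} (i : I)
    (p : Quiver.Path (x i) z) : free.Idx k x z :=
  equivShrink _ ⟨i, p⟩

/-- The generator at which a path in `free.Idx` begins. -/
noncomputable def free.gen {I : Type*} [Finite I] (x : I → Q) {z : Q} (s : free.Idx k x z) : I :=
  ((equivShrink _).symm s).1

/-- The path underlying an element of `free.Idx`. -/
noncomputable def free.path {I : Type*} [Finite I] (x : I → Q) {z : Q} (s : free.Idx k x z) :
    Quiver.Path (x (free.gen k x s)) z :=
  ((equivShrink _).symm s).2

section

variable {I : Type*} [Finite I] (x : I → Q)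

lemma free.idx_path {z : Q} (s : free.Idx k x z) : idx k x (gen k x s) (path k x s) = s :=
  (equivShrink _).apply_symm_apply s

lemma free.idx_injective {z : Q} {i j : I} {p : Quiver.Path (x i) z} {q : Quiver.Path (x j) z}
    (h : idx k x i p = idx k x j q) :
    (⟨i, p⟩ : Σ i, Quiver.Path (x i) z) = ⟨j, q⟩ :=
  (equivShrink _).injective h

/-- A function of generators and paths, evaluated on an index. -/
lemma free.apply_idx {z : Q} {α : Sort*} (F : ∀ i, Quiver.Path (x i) z → α) (i : I)
    (p : Quiver.Path (x i) z) :
    F (gen k x (idx k x i p)) (path k x (idx k x i p)) = F i p :=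
  congrArg (fun t : Σ i, Quiver.Path (x i) z => F t.1 t.2)
    ((equivShrink.{u} (Σ i, Quiver.Path (x i) z)).symm_apply_apply ⟨i, p⟩)

instance (z : Q) : Finite (free.Idx k x z) := Finite.of_equiv _ (equivShrink _)

variable [Field k]

/-- The space at a vertex of a free representation. -/
noncomputable abbrev free.space (z : Q) : FGModuleCat.{u} k :=
  FGModuleCat.of k (free.Idx k x z →₀ k)

/-- The extension of paths, as a linear map. -/
noncomputable def free.extend {z z' : Q} (p : Quiver.Path z z') :
    (free.Idx k x z →₀ k) →ₗ[k] (free.Idx k x z' →₀ k) :=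
  Finsupp.lmapDomain k k fun s => free.idx k x (free.gen k x s) ((free.path k x s).comp p)

/-- The extension of paths, as a morphism. -/
noncomputable def free.extendHom {z z' : Q} (p : Quiver.Path z z') :
    free.space k x z ⟶ free.space k x z' :=
  FGModuleCat.ofHom (free.extend k x p)

lemma free.extend_single {z z' : Q} (p : Quiver.Path z z') (s : free.Idx k x z) (c : k) :
    free.extend k x p (Finsupp.single s c) =
      Finsupp.single (free.idx k x (free.gen k x s) ((free.path k x s).comp p)) c :=
  Finsupp.mapDomain_single

lemma free.extend_nil (z : Q) :
    free.extend k x (.nil : Quiver.Path z z) = LinearMap.id := by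
  refine Finsupp.lhom_ext' fun s => LinearMap.ext_ring ?_
  refine (free.extend_single k x _ s 1).trans ?_
  exact congrArg (Finsupp.single · 1) (free.idx_path k x s)

lemma free.extend_comp {z z' z'' : Q} (p : Quiver.Path z z') (q : Quiver.Path z' z'') :
    free.extend k x (p.comp q) = free.extend k x q ∘ₗ free.extend k x p := by
  refine Finsupp.lhom_ext' fun s => LinearMap.ext_ring ?_
  change free.extend k x (p.comp q) (Finsupp.single s 1) =
    free.extend k x q (free.extend k x p (Finsupp.single s 1))
  rw [free.extend_single, free.extend_single, free.extend_single,
    free.apply_idx k x (fun i r => free.idx k x i (r.comp q)), Quiver.Path.comp_assoc]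

/-- The free representation on generators `i : I`, the generator `i` being placed at the vertex
`x i`: its basis at `z` consists of the paths from some `x i` to `z`. It is the direct sum of the
indecomposable projectives at the vertices `x i`. -/
noncomputable def free : Rep k Q where
  obj z := free.space k x z
  map p := free.extendHom k x p
  map_id z := FGModuleCat.hom_ext (free.extend_nil k x z)
  map_comp p q := FGModuleCat.hom_ext (free.extend_comp k x p q)

/-- The basis element of a free representation given by a generator and a path starting there. -/
noncomputable def free.basisElt {z : Q} (i : I) (p : Quiver.Path (x i) z) : (free k x).obj z :=
  (Finsupp.single (idx k x i p) 1 : Idx k x z →₀ k)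

lemma free.act_basisElt {z z' : Q} (i : I) (p : Quiver.Path (x i) z) (q : Quiver.Path z z') :
    act (free k x) q (basisElt k x i p) = basisElt k x i (p.comp q) := by
  change extend k x q (Finsupp.single (idx k x i p) 1) = Finsupp.single _ 1
  rw [extend_single, apply_idx k x (fun i r => idx k x i (r.comp q))]

variable {k}

lemma free.linearMap_ext {z : Q} {V : Type*} [AddCommGroup V] [Module k V]
    {f g : (free k x).obj z →ₗ[k] V}
    (h : ∀ i (p : Quiver.Path (x i) z), f (basisElt k x i p) = g (basisElt k x i p)) : f = g := by
  have : ∀ f g : (Idx k x z →₀ k) →ₗ[k] V,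
      (∀ s, f (Finsupp.single s 1) = g (Finsupp.single s 1)) → f = g := fun f g h =>
    Finsupp.lhom_ext' fun s => LinearMap.ext_ring (h s)
  refine this f g fun s => ?_
  rw [← idx_path k x s]
  exact h _ _

/-- The linear map at a vertex of `free.lift`. -/
noncomputable def free.liftLin {N : Rep k Q} (n : ∀ i, N.obj (x i)) (z : Q) :
    (free k x).obj z →ₗ[k] N.obj z :=
  Finsupp.linearCombination k fun s : Idx k x z => act N (path k x s) (n _)

lemma free.liftLin_basisElt {N : Rep k Q} (n : ∀ i, N.obj (x i)) {z : Q} (i : I)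
    (p : Quiver.Path (x i) z) : liftLin x n z (basisElt k x i p) = act N p (n i) := by
  change Finsupp.linearCombination k _ (Finsupp.single _ 1) = _
  rw [Finsupp.linearCombination_single, one_smul, apply_idx k x (fun i r => act N r (n i))]

/-- The morphism from a free representation with prescribed values on the generators. -/
noncomputable def free.lift {N : Rep k Q} (n : ∀ i, N.obj (x i)) : free k x ⟶ N :=
  homMk (liftLin x n) fun {z z'} a m => by
    refine LinearMap.congr_fun (free.linearMap_ext x (f := liftLin x n z' ∘ₗ
      act (free k x) a.toPath) (g := act N a.toPath ∘ₗ liftLin x n z) fun i p => ?_) m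
    rw [LinearMap.comp_apply, LinearMap.comp_apply, act_basisElt, liftLin_basisElt,
      liftLin_basisElt, act_comp]

lemma free.lift_basisElt {N : Rep k Q} (n : ∀ i, N.obj (x i)) {z : Q} (i : I)
    (p : Quiver.Path (x i) z) :
    appLin (free.lift x n) z (basisElt k x i p) = act N p (n i) :=
  liftLin_basisElt x n i p

lemma free.hom_ext {N : Rep k Q} {f g : free k x ⟶ N}
    (h : ∀ i, appLin f (x i) (basisElt k x i .nil) = appLin g (x i) (basisElt k x i .nil)) :
    f = g := by
  refine hom_ext_appLin fun z m => LinearMap.congr_fun (linearMap_ext x fun i p => ?_) m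
  rw [← Quiver.Path.nil_comp p, ← act_basisElt, appLin_act, appLin_act, h]

instance : Projective (free k x) where
  factors {E X} f e he := by
    choose n hn using fun i => appLin_surjective e (x i) (appLin f (x i) (free.basisElt k x i .nil))
    refine ⟨free.lift x n, free.hom_ext x fun i => ?_⟩
    rw [appLin_comp, free.lift_basisElt, act_nil, hn]

end

variable {k} in
instance [Field k] [Finite Q] : EnoughProjectives (Rep k Q) where
  presentation M := by
    let x : (Σ z : Q, Fin (dimAt M z)) → Q := Sigma.fst
    let b := fun z : Q => Module.finBasis k (M.obj z)
    let f : free k x ⟶ M := free.lift x fun s => b s.1 s.2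
    have : Epi f := by
      refine epi_of_surjective f fun z => ?_
      rw [← LinearMap.range_eq_top, eq_top_iff, ← (b z).span_eq, Submodule.span_le]
      rintro _ ⟨j, rfl⟩
      refine ⟨free.basisElt k x ⟨z, j⟩ .nil, ?_⟩
      exact (free.lift_basisElt x (fun s => b s.1 s.2) ⟨z, j⟩ .nil).trans (act_nil M z _)
    exact ⟨⟨free k x, f⟩⟩

end Free

/-! ### Simple representations and heredity -/

section Simple

variable (k : Type u) [Field k] {Q : Type v} [Quiver.{w} Q]

/-- The simple representation at the vertex `x`: one-dimensional at `x` and zero elsewhere, with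
basis at `z` the proofs of `z = x`. -/
noncomputable def simple (x : Q) : Rep k Q :=
  Paths.lift
    { obj := fun z => FGModuleCat.of k (PLift (z = x) →₀ k)
      map := fun {_ _} _ => 0 }

/-- The generator of the simple representation at `x`. -/
noncomputable def simple.gen (x : Q) : (simple k x).obj x :=
  (Finsupp.single ⟨rfl⟩ 1 : PLift (x = x) →₀ k)

lemma simple.act_toPath (x : Q) {y z : Q} (a : y ⟶ z) (m : (simple k x).obj y) :
    act (simple k x) a.toPath m = 0 :=
  LinearMap.congr_fun (congrArg (fun t => t.hom.hom) (Paths.lift_toPath (C := FGModuleCat.{u} k)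
    { obj := fun z => FGModuleCat.of k (PLift (z = x) →₀ k)
      map := fun {_ _} _ => 0 } a)) m

lemma dimAt_simple_self (x : Q) : dimAt (simple k x) x = 1 := by
  have : Fintype (PLift (x = x)) := ⟨{⟨rfl⟩}, fun _ => by simp [Subsingleton.elim _ (PLift.up rfl)]⟩
  change Module.finrank k (PLift (x = x) →₀ k) = 1
  rw [Module.finrank_finsupp_self, Fintype.card_eq_one_iff]
  exact ⟨⟨rfl⟩, fun _ => rfl⟩

lemma dimAt_simple_of_ne {x z : Q} (h : z ≠ x) : dimAt (simple k x) z = 0 := by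
  have : IsEmpty (PLift (z = x)) := ⟨fun t => h t.down⟩
  change Module.finrank k (PLift (z = x) →₀ k) = 0
  exact Module.finrank_zero_of_subsingleton

variable {k}

lemma simple.exists_eq_smul_gen {x : Q} (m : (simple k x).obj x) : ∃ c : k, m = c • gen k x :=
  ((finrank_eq_one_iff_of_nonzero' (gen k x) (Finsupp.single_ne_zero.2 one_ne_zero)).1
    (dimAt_simple_self k x) m).imp fun _ h => h.symm

lemma simple.eq_zero_of_ne {x z : Q} (h : z ≠ x) (m : (simple k x).obj z) : m = 0 := by
  have : Subsingleton ((simple k x).obj z) := Module.finrank_zero_iff.1 (dimAt_simple_of_ne k h)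
  exact Subsingleton.elim _ _

/-- The linear map at a vertex of `simple.lift`. -/
noncomputable def simple.liftLin {M : Rep k Q} {x : Q} (v : M.obj x) (z : Q) :
    (simple k x).obj z →ₗ[k] M.obj z :=
  Finsupp.linearCombination k fun h : PLift (z = x) => (h.down ▸ v : M.obj z)

lemma simple.liftLin_gen {M : Rep k Q} {x : Q} (v : M.obj x) : liftLin v x (gen k x) = v := by
  change Finsupp.linearCombination k _ (Finsupp.single _ 1) = _
  rw [Finsupp.linearCombination_single, one_smul]

/-- The morphism from a simple representation given by a vector killed by all arrows. -/
noncomputable def simple.lift {M : Rep k Q} {x : Q} (v : M.obj x)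
    (hv : ∀ (y : Q) (a : x ⟶ y), act M a.toPath v = 0) : simple k x ⟶ M :=
  homMk (simple.liftLin v) fun {y z} a m => by
    rw [simple.act_toPath, map_zero]
    by_cases hy : y = x
    · subst hy
      obtain ⟨c, rfl⟩ := simple.exists_eq_smul_gen m
      rw [map_smul, map_smul, simple.liftLin_gen, hv, smul_zero]
    · rw [simple.eq_zero_of_ne hy m, map_zero, map_zero]

lemma simple.lift_gen {M : Rep k Q} {x : Q} (v : M.obj x)
    (hv : ∀ (y : Q) (a : x ⟶ y), act M a.toPath v = 0) :
    appLin (simple.lift v hv) x (gen k x) = v :=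
  liftLin_gen v

lemma simple.hom_ext {M : Rep k Q} {x : Q} {f g : simple k x ⟶ M}
    (h : appLin f x (gen k x) = appLin g x (gen k x)) : f = g := by
  refine hom_ext_appLin fun z m => ?_
  by_cases hz : z = x
  · subst hz
    obtain ⟨c, rfl⟩ := exists_eq_smul_gen m
    rw [map_smul, map_smul, h]
  · rw [eq_zero_of_ne hz m, map_zero, map_zero]

lemma simple.mono_of_ne_zero {M : Rep k Q} {x : Q} (f : simple k x ⟶ M)
    (h : appLin f x (gen k x) ≠ 0) : Mono f := by
  refine mono_of_injective f fun z => (injective_iff_map_eq_zero _).2 fun m hm => ?_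
  by_cases hz : z = x
  · subst hz
    obtain ⟨c, rfl⟩ := exists_eq_smul_gen m
    rw [map_smul] at hm
    rw [(smul_eq_zero.1 hm).resolve_right h, zero_smul]
  · exact eq_zero_of_ne hz m

lemma toPath_comp_injective {x z y y' : Q} {a : x ⟶ y} {a' : x ⟶ y'} {p : Quiver.Path y z}
    {p' : Quiver.Path y' z} (h : a.toPath.comp p = a'.toPath.comp p') :
    (⟨⟨y, a⟩, p⟩ : Σ s : (Σ y, (x ⟶ y)), Quiver.Path s.1 z) = ⟨⟨y', a'⟩, p'⟩ := by
  induction p with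
  | nil =>
    cases p' with
    | nil =>
      have : a = a' := by
        simpa [Quiver.Hom.toPath] using h
      rw [this]
    | cons q b =>
      have := congrArg Quiver.Path.length h
      simp at this
  | cons q b ih =>
    cases p' with
    | nil =>
      have := congrArg Quiver.Path.length h
      simp at this
    | cons q' b' =>
      rw [Quiver.Path.comp_cons, Quiver.Path.comp_cons] at h
      obtain rfl := Quiver.Path.obj_eq_of_cons_eq_cons h
      obtain rfl := eq_of_heq (Quiver.Path.hom_heq_of_cons_eq_cons h)
      have := ih (eq_of_heq (Quiver.Path.heq_of_cons_eq_cons h))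
      cases this
      rfl

/-- The projective resolution `0 ⟶ ⨁ P_y ⟶ P_x ⟶ S_x ⟶ 0` of a simple representation, where the sum
is over the arrows `x ⟶ y`. -/
lemma simple.exists_resolution [Finite Q] [∀ x y : Q, Finite (x ⟶ y)]
    [∀ x y : Q, Finite (Quiver.Path x y)] (x : Q) :
    ∃ (R P : Rep k Q) (f : R ⟶ P) (g : P ⟶ simple k x) (z : f ≫ g = 0),
      (ShortComplex.mk f g z).ShortExact ∧ Projective R ∧ Projective P := by
  let t : (Σ y, (x ⟶ y)) → Q := Sigma.fst
  let c : Unit → Q := fun _ => x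
  let f : free k t ⟶ free k c := free.lift t fun a => free.basisElt k c () a.2.toPath
  let g : free k c ⟶ simple k x := free.lift c fun _ => gen k x
  have hf : ∀ {z : Q} (a : Σ y, (x ⟶ y)) (p : Quiver.Path a.1 z),
      appLin f z (free.basisElt k t a p) = free.basisElt k c () (a.2.toPath.comp p) :=
    fun a p => (free.lift_basisElt t _ a p).trans (free.act_basisElt k c () _ p)
  have hz : f ≫ g = 0 := by
    refine free.hom_ext t fun a => ?_
    rw [appLin_comp, hf, free.lift_basisElt, appLin_zero, act_comp, act_toPath, map_zero]
  have hmono : Mono f := by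
    refine mono_of_injective f fun z => ?_
    let φ : free.Idx k t z → free.Idx k c z := fun s =>
      free.idx k c () ((free.gen k t s).2.toPath.comp (free.path k t s))
    have hφ : Function.Injective φ := by
      intro s s' h
      have h1 : (free.gen k t s).2.toPath.comp (free.path k t s) =
          (free.gen k t s').2.toPath.comp (free.path k t s') := by
        simpa using free.idx_injective k c h
      rw [← free.idx_path k t s, ← free.idx_path k t s']
      exact congrArg (fun r : Σ s : (Σ y, (x ⟶ y)), Quiver.Path s.1 z => free.idx k t r.1 r.2)
        (toPath_comp_injective h1)
    have : appLin f z = Finsupp.lmapDomain k k φ := by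
      refine free.linearMap_ext t fun a p => ?_
      refine (hf a p).trans ?_
      change _ = Finsupp.mapDomain φ (Finsupp.single (free.idx k t a p) 1)
      rw [Finsupp.mapDomain_single]
      exact congrArg (Finsupp.single · 1) (free.apply_idx k t (fun (a : Σ y, (x ⟶ y)) r =>
        free.idx k c () (a.2.toPath.comp r)) a p).symm
    rw [this]
    exact Finsupp.mapDomain_injective hφ
  have hgen : appLin g x (free.basisElt k c () .nil) = gen k x :=
    (free.lift_basisElt c (fun _ => gen k x) () .nil).trans (act_nil _ _ _)
  have hepi : Epi g := by
    refine Preadditive.epi_of_cancel_zero _ fun {L} h hh => hom_ext ?_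
    rw [appLin_zero, ← hgen, ← appLin_comp, hh, appLin_zero]
  refine ⟨_, _, f, g, hz, { exact := ?_ }, inferInstance, inferInstance⟩
  have key : ∀ {W : Rep k Q} (h : free k c ⟶ W), f ≫ h = 0 → ∃ m : simple k x ⟶ W, g ≫ m = h := by
    intro W h hh
    refine ⟨simple.lift (appLin h x (free.basisElt k c () .nil)) fun y a => ?_,
      free.hom_ext c fun _ => ?_⟩
    · rw [← appLin_act, free.act_basisElt, Quiver.Path.nil_comp]
      have := hf ⟨y, a⟩ .nil
      rw [Quiver.Path.comp_nil] at this
      rw [← this, ← appLin_comp, hh, appLin_zero]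
    · refine (appLin_comp g _ x _).trans ?_
      rw [hgen, simple.lift_gen]
  choose! m hm using @key
  exact ShortComplex.exact_of_g_is_cokernel _ (CokernelCofork.IsColimit.ofπ _ _
    (fun h hh => m h) (fun h hh => hm h hh) fun h hh m' hm' => by
      rw [← cancel_epi g, hm h hh]
      exact hm')

end Simple

/-! ### Finiteness and additivity of the Euler pairing -/

section Euler

variable (k : Type*) [Field k]

lemma finrank_eq_add_of_exact {U V W : Type*} [AddCommGroup U] [Module k U] [AddCommGroup V]
    [Module k V] [AddCommGroup W] [Module k W] [Module.Finite k V] (f : U →ₗ[k] V) (g : V →ₗ[k] W)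
    (h : ∀ y, g y = 0 ↔ ∃ x, f x = y) :
    Module.finrank k V =
      Module.finrank k (LinearMap.range f) + Module.finrank k (LinearMap.range g) := by
  have : LinearMap.range f = LinearMap.ker g := by
    ext y
    exact (h y).symm
  rw [this, add_comm]
  exact g.finrank_range_add_finrank_ker.symm

variable {C : Type*} [Category C] [Abelian C] [HasExt.{w} C] [Linear k C]
  [∀ X Y : C, Module.Finite k (X ⟶ Y)]

/-- With enough projectives, `Ext¹(X, Y)` is a quotient of a space of morphisms. -/
lemma finite_ext_one [EnoughProjectives C] (X Y : C) : Module.Finite k (Ext X Y 1) := by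
  have hS := kernel_shortExact (Projective.π X)
  let φ : (kernel (Projective.π X) ⟶ Y) →ₗ[k] Ext X Y 1 :=
    hS.extClass.precompOfLinear k Y (add_zero 1) ∘ₗ
      (Ext.linearEquiv₀ (R := k)).symm.toLinearMap
  refine Module.Finite.of_surjective φ fun ξ => ?_
  obtain ⟨y, hy⟩ := Ext.contravariant_sequence_exact₃ hS Y ξ (Ext.eq_zero_of_projective _)
    (add_zero 1)
  exact ⟨Ext.linearEquiv₀ (R := k) y, by
    simp only [φ, LinearMap.comp_apply, LinearEquiv.coe_coe, LinearEquiv.symm_apply_apply]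
    exact hy⟩

lemma euler_shortExact [∀ X Y : C, Module.Finite k (Ext X Y 1)] {T : C}
    (h2 : ∀ X, Subsingleton (Ext T X 2)) {S : ShortComplex C} (hS : S.ShortExact) :
    (Module.finrank k (T ⟶ S.X₂) : ℤ) - Module.finrank k (Ext T S.X₂ 1) =
      ((Module.finrank k (T ⟶ S.X₁) : ℤ) - Module.finrank k (Ext T S.X₁ 1)) +
      ((Module.finrank k (T ⟶ S.X₃) : ℤ) - Module.finrank k (Ext T S.X₃ 1)) := by
  have hfin : ∀ X, Module.Finite k (Ext T X 0) := fun X =>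
    Module.Finite.equiv (Ext.linearEquiv₀ (R := k) (X := T) (Y := X)).symm
  have hhom : ∀ X, Module.finrank k (T ⟶ X) = Module.finrank k (Ext T X 0) := fun X =>
    (Ext.linearEquiv₀ (R := k) (X := T) (Y := X)).finrank_eq.symm
  let f₀ := (Ext.mk₀ S.f).postcompOfLinear k T (add_zero 0)
  let g₀ := (Ext.mk₀ S.g).postcompOfLinear k T (add_zero 0)
  let δ := hS.extClass.postcompOfLinear k T (zero_add 1)
  let f₁ := (Ext.mk₀ S.f).postcompOfLinear k T (add_zero 1)
  let g₁ := (Ext.mk₀ S.g).postcompOfLinear k T (add_zero 1)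
  have hmono := hS.mono_f
  have e₁ : Module.finrank k (LinearMap.range f₀) = Module.finrank k (Ext T S.X₁ 0) :=
    LinearMap.finrank_range_of_inj (Ext.postcomp_mk₀_injective_of_mono T S.f)
  have hfg : ∀ {n : ℕ} (x : Ext T S.X₁ n),
      (x.comp (Ext.mk₀ S.f) (add_zero n)).comp (Ext.mk₀ S.g) (add_zero n) = 0 := fun x => by
    rw [Ext.comp_assoc_of_second_deg_zero, Ext.mk₀_comp_mk₀, S.zero, Ext.mk₀_zero, Ext.comp_zero]
  have e₂ := finrank_eq_add_of_exact k f₀ g₀ fun y =>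
    ⟨fun h => Ext.covariant_sequence_exact₂ T hS y h, by rintro ⟨x, rfl⟩; exact hfg x⟩
  have e₃ := finrank_eq_add_of_exact k g₀ δ fun y =>
    ⟨fun h => Ext.covariant_sequence_exact₃ T hS y (zero_add 1) h, by
      rintro ⟨x, rfl⟩
      change (x.comp (Ext.mk₀ S.g) (add_zero 0)).comp hS.extClass (zero_add 1) = 0
      rw [Ext.comp_assoc (a₁₂ := 0) (a₂₃ := 1) _ _ _ (by lia) (by lia) (by lia),
        hS.comp_extClass, Ext.comp_zero]⟩
  have e₄ := finrank_eq_add_of_exact k δ f₁ fun y =>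
    ⟨fun h => Ext.covariant_sequence_exact₁ T hS y h (zero_add 1), by
      rintro ⟨x, rfl⟩
      change (x.comp hS.extClass (zero_add 1)).comp (Ext.mk₀ S.f) (add_zero 1) = 0
      rw [Ext.comp_assoc (a₁₂ := 1) (a₂₃ := 1) _ _ _ (by lia) (by lia) (by lia),
        hS.extClass_comp, Ext.comp_zero]⟩
  have e₅ := finrank_eq_add_of_exact k f₁ g₁ fun y =>
    ⟨fun h => Ext.covariant_sequence_exact₂ T hS y h, by rintro ⟨x, rfl⟩; exact hfg x⟩
  have e₆ : Module.finrank k (LinearMap.range g₁) = Module.finrank k (Ext T S.X₃ 1) := by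
    have : LinearMap.range g₁ = ⊤ := by
      rw [LinearMap.range_eq_top]
      have := h2 S.X₁
      exact fun y => Ext.covariant_sequence_exact₃ T hS y rfl (Subsingleton.elim _ _)
    rw [this, finrank_top]
  rw [hhom, hhom, hhom]
  lia

end Euler

section Rep

variable {k : Type u} [Field k] {Q : Type v} [Quiver.{w} Q] [Fintype Q]

/-- A property of representations holds if it holds for zero and passes from the cokernel of a
simple subrepresentation to the representation. A nonzero representation has such a
subrepresentation at each vertex of its support from which no other vertex of the support can be
reached. -/
lemma rep_induction (hQ : IsAcyclic Q) {motive : Rep k Q → Prop}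
    (zero : ∀ M, IsZero M → motive M)
    (ext : ∀ (x : Q) {M L : Rep k Q} (f : simple k x ⟶ M) (g : M ⟶ L) (z : f ≫ g = 0),
      (ShortComplex.mk f g z).ShortExact → motive L → motive M) (M : Rep k Q) : motive M := by
  induction hn : ∑ x, dimAt M x using Nat.strong_induction_on generalizing M with
  | _ n ih =>
  by_cases h0 : ∀ x, dimAt M x = 0
  · exact zero M (isZero_of_dimAt h0)
  push Not at h0
  obtain ⟨x, hx, hmin⟩ := (wellFounded_path_swap hQ).has_min {x | dimAt M x ≠ 0} h0
  have : Nontrivial (M.obj x) := Module.nontrivial_of_finrank_pos (R := k) (Nat.pos_of_ne_zero hx)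
  obtain ⟨v, hv⟩ := exists_ne (0 : M.obj x)
  have hkill : ∀ (y : Q) (a : x ⟶ y), act M a.toPath v = 0 := fun y a => by
    have hy : dimAt M y = 0 := by
      by_contra hy
      exact hmin y hy ⟨a.toPath, by simp⟩
    have : Subsingleton (M.obj y) := Module.finrank_zero_iff.1 hy
    exact Subsingleton.elim _ _
  let f := simple.lift v hkill
  have hf : Mono f := simple.mono_of_ne_zero f (by rw [simple.lift_gen]; exact hv)
  have hS : (ShortComplex.mk f (cokernel.π f) (cokernel.condition f)).ShortExact :=
    { exact := ShortComplex.exact_cokernel f }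
  refine ext x f (cokernel.π f) (cokernel.condition f) hS (ih _ ?_ _ rfl)
  rw [← hn]
  refine Finset.sum_lt_sum (fun y _ => ?_) ⟨x, Finset.mem_univ x, ?_⟩
  · exact (Nat.le_add_left _ _).trans_eq (dimAt_shortExact hS y).symm
  · have h1 := dimAt_shortExact hS x
    dsimp only at h1
    rw [dimAt_simple_self] at h1
    lia

/-- A function of representations which is additive on short exact sequences depends on dimension
vectors only. -/
lemma eq_sum_dimAt_mul (hQ : IsAcyclic Q) {φ : Rep k Q → ℤ}
    (hφ : ∀ S : ShortComplex (Rep k Q), S.ShortExact → φ S.X₂ = φ S.X₁ + φ S.X₃) (M : Rep k Q) :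
    φ M = ∑ x, (dimAt M x : ℤ) * φ (simple k x) := by
  classical
  induction M using rep_induction hQ with
  | zero M hM =>
    have h := hφ (ShortComplex.mk (0 : M ⟶ M) (0 : M ⟶ M) (by simp))
      { exact := ShortComplex.exact_of_isZero_X₂ _ hM
        mono_f := hM.mono _
        epi_g := hM.epi _ }
    dsimp only at h
    rw [Finset.sum_eq_zero fun x _ => by rw [dimAt_of_isZero hM x, Nat.cast_zero, zero_mul]]
    lia
  | ext x f g z hS ih =>
    have h := hφ _ hS
    dsimp only at h
    rw [h, ih, eq_comm, ← sub_eq_iff_eq_add, ← Finset.sum_sub_distrib, Finset.sum_eq_single x]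
    · have h1 := dimAt_shortExact hS x
      dsimp only at h1
      rw [h1, dimAt_simple_self]
      push_cast
      ring
    · intro y _ hy
      have h1 := dimAt_shortExact hS y
      dsimp only at h1
      rw [h1, dimAt_simple_of_ne k hy, zero_add, sub_self]
    · exact fun h => absurd (Finset.mem_univ x) h

variable [∀ x y : Q, Finite (x ⟶ y)]

/-- Representations of an acyclic quiver have projective dimension at most one: this holds for the
simple ones, and passes to extensions. -/
lemma hasProjectiveDimensionLE_one (hQ : IsAcyclic Q) (M : Rep k Q) :
    HasProjectiveDimensionLE M 1 := by
  have : ∀ x y : Q, Finite (Quiver.Path x y) := finite_path hQ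
  induction M using rep_induction hQ with
  | zero M hM =>
    have := hM.hasProjectiveDimensionLT_zero
    exact hasProjectiveDimensionLT_of_ge M 0 2 (by lia)
  | ext x f g z hS ih =>
    refine hS.hasProjectiveDimensionLT_X₂ 2 ?_ ih
    obtain ⟨R, P, f', g', z', hS', hR, hP⟩ := simple.exists_resolution (k := k) x
    exact hS'.hasProjectiveDimensionLT_X₃ 1 inferInstance
      (hasProjectiveDimensionLT_of_ge P 1 2 (by lia))

lemma ext_two (hQ : IsAcyclic Q) (M N : Rep k Q) : Subsingleton (Ext M N 2) := by
  have := hasProjectiveDimensionLE_one hQ M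
  exact HasProjectiveDimensionLT.subsingleton M 2 2 le_rfl N

/-- If a projective representation has no nonzero morphisms to `T`, then neither does it have any
to a representation `M` supported on `T`, because `dim Hom(K, M)` is a linear function of the
dimension vector of `M` with nonnegative coefficients. -/
lemma hom_eq_zero_of_supp (hQ : IsAcyclic Q) {K T M : Rep k Q} [Projective K]
    (hM : supp M ⊆ supp T) (hT : ∀ f : K ⟶ T, f = 0) (f : K ⟶ M) : f = 0 := by
  have : ∀ x y : Q, Finite (Quiver.Path x y) := finite_path hQ
  have hfin : ∀ M N : Rep k Q, Module.Finite k (Ext M N 1) := finite_ext_one k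
  have hadd : ∀ S : ShortComplex (Rep k Q), S.ShortExact →
      (Module.finrank k (K ⟶ S.X₂) : ℤ) =
        (Module.finrank k (K ⟶ S.X₁) : ℤ) + (Module.finrank k (K ⟶ S.X₃) : ℤ) := by
    intro S hS
    have hK : ∀ X : Rep k Q, Module.finrank k (Ext K X 1) = 0 := fun X => by
      have := HasProjectiveDimensionLT.subsingleton K 1 1 le_rfl X
      exact Module.finrank_zero_of_subsingleton
    have := euler_shortExact k (ext_two hQ K) hS
    simpa only [hK, Nat.cast_zero, sub_zero] using this
  have key := eq_sum_dimAt_mul hQ (φ := fun X => (Module.finrank k (K ⟶ X) : ℤ)) hadd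
  have h0 : ∀ x ∈ supp T, Module.finrank k (K ⟶ simple k x) = 0 := by
    intro x hx
    have hsub : Subsingleton (K ⟶ T) := subsingleton_of_forall_eq 0 hT
    have h1 := key T
    rw [Module.finrank_zero_of_subsingleton, Nat.cast_zero, eq_comm,
      Finset.sum_eq_zero_iff_of_nonneg fun x _ => by positivity] at h1
    have h2 := (mul_eq_zero.1 (h1 x (Finset.mem_univ x))).resolve_left
      (Nat.cast_ne_zero.2 hx)
    exact Nat.cast_eq_zero.1 h2
  have h3 := key M
  rw [Finset.sum_eq_zero fun x _ => ?_] at h3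
  · have := Module.finrank_zero_iff.1 (Nat.cast_eq_zero.1 h3)
    exact Subsingleton.elim _ _
  · by_cases hx : x ∈ supp M
    · rw [h0 x (hM hx), Nat.cast_zero, mul_zero]
    · have : dimAt M x = 0 := by simpa [supp] using hx
      rw [this, Nat.cast_zero, zero_mul]

end Rep

/-! ### Supports -/

section Support

variable {k : Type u} [Field k] {Q : Type v} [Quiver.{w} Q]

lemma supp_shortExact {S : ShortComplex (Rep k Q)} (hS : S.ShortExact) :
    supp S.X₂ = supp S.X₁ ∪ supp S.X₃ := by
  ext x
  have := dimAt_shortExact hS x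
  change dimAt S.X₂ x ≠ 0 ↔ dimAt S.X₁ x ≠ 0 ∨ dimAt S.X₃ x ≠ 0
  lia

lemma supp_le_of_mono {M N : Rep k Q} (f : M ⟶ N) [Mono f] : supp M ⊆ supp N := by
  have hS : (ShortComplex.mk f (cokernel.π f) (cokernel.condition f)).ShortExact :=
    { exact := ShortComplex.exact_cokernel f }
  exact Set.subset_union_left.trans_eq (supp_shortExact hS).symm

lemma supp_le_of_epi {M N : Rep k Q} (f : M ⟶ N) [Epi f] : supp N ⊆ supp M :=
  Set.subset_union_right.trans_eq (supp_shortExact (kernel_shortExact f)).symm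

lemma isSerreClass_supp (s : Set Q) :
    ObjectProperty.IsSerreClass fun M : Rep k Q => supp M ⊆ s where
  exists_zero :=
    let ⟨Z, hZ⟩ := HasZeroObject.zero (C := Rep k Q)
    ⟨Z, hZ, fun x hx => absurd (dimAt_of_isZero hZ x) hx⟩
  prop_of_mono f _ h := (supp_le_of_mono f).trans h
  prop_of_epi f _ h := (supp_le_of_epi f).trans h
  prop_X₂_of_shortExact hS h₁ h₃ := by
    rw [supp_shortExact hS]
    exact Set.union_subset h₁ h₃

lemma supp_le_of_gen {T M : Rep k Q} (h : Gen T M) : supp M ⊆ supp T := by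
  obtain ⟨n, p, hp⟩ := h.exists_epi
  refine (supp_le_of_epi p).trans fun x hx => ?_
  by_contra hxT
  refine hx (Module.finrank_zero_iff.2 (subsingleton_of_forall_eq 0 fun m => ?_))
  have : Subsingleton (T.obj x) := Module.finrank_zero_iff.1 (not_not.1 hxT)
  let φ : ((⨁ fun _ : Fin n => T) ⟶ ⨁ fun _ : Fin n => T) →+ (⨁ fun _ : Fin n => T).obj x :=
    { toFun f := appLin f x m
      map_zero' := rfl
      map_add' _ _ := rfl }
  have h1 : φ (𝟙 _) = 0 := by
    rw [← biproduct.total, map_sum]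
    refine Finset.sum_eq_zero fun i _ => ?_
    change appLin (biproduct.ι (fun _ : Fin n => T) i) x
      (appLin (biproduct.π (fun _ : Fin n => T) i) x m) = 0
    rw [Subsingleton.elim (appLin (biproduct.π (fun _ : Fin n => T) i) x m) 0, map_zero]
  exact h1

end Support

/-! ### Decomposition into indecomposable representations -/

section Decomposition

variable {k : Type u} [Field k] {Q : Type v} [Quiver.{w} Q] [Fintype Q]

lemma sum_dimAt_lt {Y M Z : Rep k Q} (i : Y ⟶ M) [Mono i] (p : M ⟶ Z) [Epi p] (h : i ≫ p = 0)
    (hY : ¬ IsZero Y) : ∑ x, dimAt Z x < ∑ x, dimAt M x := by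
  have hS := kernel_shortExact p
  have hd := fun x => dimAt_shortExact hS x
  dsimp only at hd
  simp only [hd, Finset.sum_add_distrib]
  refine Nat.lt_add_of_pos_left (Nat.pos_of_ne_zero fun h0 => hY ?_)
  have hK : IsZero (kernel p) := isZero_of_dimAt fun x =>
    Finset.sum_eq_zero_iff.1 h0 x (Finset.mem_univ x)
  have : Mono (kernel.lift p i h) := mono_of_mono_fac (kernel.lift_ι p i h)
  exact hK.of_mono (kernel.lift p i h)

/-- Every representation is a finite direct sum of indecomposable ones; the direct sum is expressed
by inclusions `g i` and projections `f i`. -/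
lemma exists_indecomposable_decomposition (M : Rep k Q) :
    ∃ (ι : Type) (_ : Fintype ι) (X : ι → Rep k Q) (f : ∀ i, M ⟶ X i) (g : ∀ i, X i ⟶ M),
      (∀ i, Indecomposable (X i)) ∧ (∀ i, g i ≫ f i = 𝟙 (X i)) ∧ ∑ i, f i ≫ g i = 𝟙 M := by
  induction hn : ∑ x, dimAt M x using Nat.strong_induction_on generalizing M with
  | _ n ih =>
  subst hn
  by_cases h0 : IsZero M
  · exact ⟨Empty, inferInstance, Empty.elim, fun i => i.elim, fun i => i.elim, fun i => i.elim,
      fun i => i.elim, h0.eq_of_src _ _⟩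
  by_cases hM : Indecomposable M
  · exact ⟨Unit, inferInstance, fun _ => M, fun _ => 𝟙 M, fun _ => 𝟙 M, fun _ => hM, by simp,
      by simp⟩
  unfold Indecomposable at hM
  push Not at hM
  obtain ⟨Y, Z, e, hY, hZ⟩ := hM h0
  obtain ⟨ι₁, _, X₁, f₁, g₁, hX₁, hgf₁, hfg₁⟩ := ih _ (sum_dimAt_lt (biprod.inr ≫ e.inv)
    (e.hom ≫ biprod.fst) (by simp) hZ) Y rfl
  obtain ⟨ι₂, _, X₂, f₂, g₂, hX₂, hgf₂, hfg₂⟩ := ih _ (sum_dimAt_lt (biprod.inl ≫ e.inv)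
    (e.hom ≫ biprod.snd) (by simp) hY) Z rfl
  refine ⟨ι₁ ⊕ ι₂, inferInstance, Sum.elim X₁ X₂,
    Sum.rec (fun i => e.hom ≫ biprod.fst ≫ f₁ i) fun i => e.hom ≫ biprod.snd ≫ f₂ i,
    Sum.rec (fun i => g₁ i ≫ biprod.inl ≫ e.inv) fun i => g₂ i ≫ biprod.inr ≫ e.inv,
    Sum.rec hX₁ hX₂, ?_, ?_⟩
  · rintro (i | i)
    · change (g₁ i ≫ biprod.inl ≫ e.inv) ≫ e.hom ≫ biprod.fst ≫ f₁ i = 𝟙 (X₁ i)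
      simpa using hgf₁ i
    · change (g₂ i ≫ biprod.inr ≫ e.inv) ≫ e.hom ≫ biprod.snd ≫ f₂ i = 𝟙 (X₂ i)
      simpa using hgf₂ i
  · have h₁ : ∑ i, (e.hom ≫ biprod.fst ≫ f₁ i) ≫ g₁ i ≫ biprod.inl ≫ e.inv =
        e.hom ≫ biprod.fst ≫ (∑ i, f₁ i ≫ g₁ i) ≫ biprod.inl ≫ e.inv := by
      simp only [Preadditive.sum_comp, Preadditive.comp_sum, Category.assoc]
    have h₂ : ∑ i, (e.hom ≫ biprod.snd ≫ f₂ i) ≫ g₂ i ≫ biprod.inr ≫ e.inv =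
        e.hom ≫ biprod.snd ≫ (∑ i, f₂ i ≫ g₂ i) ≫ biprod.inr ≫ e.inv := by
      simp only [Preadditive.sum_comp, Preadditive.comp_sum, Category.assoc]
    rw [Fintype.sum_sum_type]
    refine (congrArg₂ (· + ·) h₁ h₂).trans ?_
    rw [hfg₁, hfg₂, Category.id_comp, Category.id_comp]
    have := congrArg (fun t => e.hom ≫ t ≫ e.inv) (biprod.total (X := Y) (Y := Z))
    simpa only [Preadditive.add_comp, Preadditive.comp_add, Category.assoc, Category.id_comp,
      e.hom_inv_id] using this

/-- The indecomposable summands of a representation, without repetition. -/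
lemma exists_basic_decomposition (M : Rep k Q) :
    ∃ (r : ℕ) (T : Fin r → Rep k Q), (∀ i, Indecomposable (T i)) ∧
      (∀ i j, Nonempty (T i ≅ T j) → i = j) ∧ (∀ i, Nonempty (Retract (T i) M)) ∧
      ∃ (ι : Type) (_ : Finite ι) (c : ι → Fin r), Nonempty (Retract M (⨁ fun i => T (c i))) := by
  obtain ⟨ι, _, X, f, g, hX, hgf, hfg⟩ := exists_indecomposable_decomposition M
  let s : Setoid ι :=
    { r i j := Nonempty (X i ≅ X j)
      iseqv := ⟨fun _ => ⟨Iso.refl _⟩, fun ⟨e⟩ => ⟨e.symm⟩, fun ⟨e⟩ ⟨e'⟩ => ⟨e ≪≫ e'⟩⟩ }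
  obtain ⟨r, ⟨q⟩⟩ := Finite.exists_equiv_fin (Quotient s)
  have hc : ∀ i, Nonempty (X i ≅ X (q.symm (q ⟦i⟧)).out) := fun i => by
    rw [q.symm_apply_apply]
    exact Setoid.symm (Quotient.mk_out i)
  let e := fun i => (hc i).some
  refine ⟨r, fun m => X (q.symm m).out, fun m => hX _, fun m m' h => ?_,
    fun m => ⟨⟨g _, f _, hgf _⟩⟩, ι, inferInstance, fun i => q ⟦i⟧,
    ⟨⟨biproduct.lift fun i => f i ≫ (e i).hom, biproduct.desc fun i => (e i).inv ≫ g i, ?_⟩⟩⟩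
  · have := Quotient.sound (s := s) h
    rwa [Quotient.out_eq, Quotient.out_eq, q.symm.injective.eq_iff] at this
  · rw [biproduct.lift_desc]
    simpa using hfg

end Decomposition

/-! ### Stability conditions -/

section StabilityCondition

variable {k : Type u} [Field k] {Q : Type v} [Quiver.{w} Q] [Fintype Q]

/-- The dimension vectors of the simple representations form the standard basis. -/
lemma eq_of_dimVec {θ θ' : K0 Q →+ ℤ} (h : ∀ M : Rep k Q, θ (dimVec M) = θ' (dimVec M)) :
    θ = θ' := by
  classical
  have hx : ∀ x : Q, dimVec (simple k x) = Pi.single x 1 := fun x => by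
    ext y
    rcases eq_or_ne y x with rfl | hy
    · simp [dimVec, dimAt_simple_self]
    · simp [dimVec, dimAt_simple_of_ne k hy, hy]
  refine AddMonoidHom.functions_ext _ _ _ fun x n => ?_
  have hn : (Pi.single x n : K0 Q) = n • Pi.single x 1 := by
    rw [← Pi.single_smul, smul_eq_mul, mul_one]
  rw [hn, map_zsmul, map_zsmul, ← hx, h]

/-- An additive function of representations factors uniquely through the dimension vector. -/
lemma existsUnique_dimVec (hQ : IsAcyclic Q) {φ : Rep k Q → ℤ}
    (hφ : ∀ S : ShortComplex (Rep k Q), S.ShortExact → φ S.X₂ = φ S.X₁ + φ S.X₃) :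
    ∃! θ : K0 Q →+ ℤ, ∀ M, θ (dimVec M) = φ M := by
  have h : ∀ M, (∑ x, (AddMonoidHom.mulRight (φ (simple k x))).comp
      (Pi.evalAddMonoidHom (fun _ => ℤ) x)) (dimVec M) = φ M := fun M => by
    rw [eq_sum_dimAt_mul hQ hφ M]
    simp [dimVec]
  exact ⟨_, h, fun θ hθ => eq_of_dimVec fun M => (hθ M).trans (h M).symm⟩

variable [∀ x y : Q, Finite (x ⟶ y)]

lemma euler_additive (hQ : IsAcyclic Q) (T : Rep k Q) {S : ShortComplex (Rep k Q)}
    (hS : S.ShortExact) : euler T S.X₂ = euler T S.X₁ + euler T S.X₃ := by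
  have : ∀ x y : Q, Finite (Quiver.Path x y) := finite_path hQ
  have : ∀ M N : Rep k Q, Module.Finite k (Ext M N 1) := finite_ext_one k
  exact euler_shortExact k (ext_two hQ T) hS

lemma existsUnique_isStabilityOf (hQ : IsAcyclic Q) {r : ℕ} (T : Fin r → Rep k Q) (a : Fin r → ℤ)
    (b : Q → ℤ) : ∃! θ : K0 Q →+ ℤ, IsStabilityOf T a b θ := by
  refine existsUnique_dimVec hQ fun S hS => ?_
  simp only [euler_additive hQ _ hS, dimAt_shortExact hS, Nat.cast_add, mul_add,
    Finset.sum_add_distrib]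
  ring

/-- By heredity `Ext¹(T, -)` is right exact, hence vanishes on `Gen T` as soon as it vanishes
on `T`. -/
lemma IsSupportTilting.isTiltingFamily (hQ : IsAcyclic Q) {r : ℕ} {T : Fin r → Rep k Q}
    (hT : IsSupportTilting (⨁ T)) :
    IsTiltingFamily (fun M : Rep k Q => supp M ⊆ supp (⨁ T)) T where
  serre := isSerreClass_supp _
  gen_le _ h := supp_le_of_gen h
  ext_gen i X h := by
    obtain ⟨n, p, hp⟩ := h.exists_epi
    refine ext_X₃_right (kernel_shortExact p) one_add_one_eq_two (ext_two hQ _ _)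
      (ext_biproduct_right fun _ => ?_)
    exact ext_retract_left (retractBiproduct T i) hT.ext_self
  gen_of_ext X hX h := hT.gen_of_ext X hX (ext_biproduct_left h)

lemma wideOf_gen_eq_semistable (hQ : IsAcyclic Q) {r : ℕ} {T : Fin r → Rep k Q}
    (hind : ∀ i, Indecomposable (T i)) (hT : IsSupportTilting (⨁ T)) {a : Fin r → ℤ} {b : Q → ℤ}
    (ha₀ : ∀ i, IsSplitProjective (Gen (⨁ T)) (T i) → a i = 0)
    (ha₁ : ∀ i, IsExtProjective (Gen (⨁ T)) (T i) → ¬ IsSplitProjective (Gen (⨁ T)) (T i) → 0 < a i)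
    (hb : ∀ j, j ∉ supp (⨁ T) → b j < 0) {θ : K0 Q →+ ℤ} (hθ : IsStabilityOf T a b θ) :
    wideOf (Gen (⨁ T)) = semistable k θ := by
  classical
  have : ∀ x y : Q, Finite (Quiver.Path x y) := finite_path hQ
  have : ∀ M N : Rep k Q, Module.Finite k (Ext M N 1) := finite_ext_one k
  have hF := hT.isTiltingFamily hQ
  have hterm : ∀ M : Rep k Q, ∀ j ∈ Finset.univ.filter (fun j => j ∉ supp (⨁ T)),
      b j * (dimAt M j : ℤ) ≤ 0 := fun M j hj =>
    mul_nonpos_of_nonpos_of_nonneg (hb j (Finset.mem_filter.1 hj).2).le (Nat.cast_nonneg _)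
  ext B
  refine hF.wideOf_iff k hind (θ := fun M => θ (dimVec M)) ha₀
    (fun i => ha₁ i ⟨gen_biproduct T i, hF.ext_gen i⟩)
    (β := fun M => ∑ j ∈ Finset.univ.filter (fun j => j ∉ supp (⨁ T)), b j * (dimAt M j : ℤ))
    (fun M => Finset.sum_nonpos (hterm M)) (fun M => ?_) (fun M => ?_) (fun S hS => ?_) B
  · rw [Finset.sum_eq_zero_iff_of_nonpos (hterm M)]
    constructor
    · intro h x hx
      by_contra hxT
      have := (mul_eq_zero.1 (h x (by simpa using hxT))).resolve_left (hb x hxT).ne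
      exact hx (Nat.cast_eq_zero.1 this)
    · intro h j hj
      have : dimAt M j = 0 := by
        by_contra hM
        exact (Finset.mem_filter.1 hj).2 (h hM)
      rw [this, Nat.cast_zero, mul_zero]
  · exact hθ M
  · rw [← map_add]
    congr 1
    ext x
    simp only [dimVec, Pi.add_apply, dimAt_shortExact hS x, Nat.cast_add]

end StabilityCondition

/-! ### Support tilting representations and finitely generated wide subcategories -/

section SupportTilting

variable {k : Type u} [Field k] {Q : Type v} [Quiver.{w} Q] [Fintype Q]

/-- The direct sum of the indecomposable projectives at all vertices is a generator. -/
lemma isZero_of_hom_free [∀ x y : Q, Finite (Quiver.Path x y)] {F : Rep k Q}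
    (h : ∀ f : free k (id : Q → Q) ⟶ F, f = 0) : IsZero F := by
  classical
  refine isZero_of_dimAt fun x => Module.finrank_zero_iff.2 ?_
  refine subsingleton_of_forall_eq 0 fun m => ?_
  have h1 := free.lift_basisElt (id : Q → Q) (Pi.single x m : ∀ i : Q, F.obj i) x .nil
  rw [h (free.lift _ _), appLin_zero, act_nil, Pi.single_eq_same] at h1
  exact h1.symm

variable [∀ x y : Q, Finite (x ⟶ y)]

/-- In an extension-closed subcategory, split projective objects are Ext-projective. -/
lemma IsSplitProjective.subsingleton_ext {C : Type*} [Category C] [Abelian C] [HasExt.{w} C]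
    [EnoughProjectives C] {𝒯 : ObjectProperty C} [𝒯.IsClosedUnderExtensions] {P X : C}
    (hP : IsSplitProjective 𝒯 P) (hX : 𝒯 X) : Subsingleton (Ext P X 1) := by
  refine subsingleton_of_forall_eq 0 fun ξ => ?_
  obtain ⟨E, f, g, z, hE, rfl⟩ := exists_shortExact_extClass_eq ξ
  obtain ⟨⟨s⟩⟩ := hP.2 E g (𝒯.prop_X₂_of_shortExact hE hX hP.1) hE.epi_g
  have h : (Ext.mk₀ s.section_).comp ((Ext.mk₀ g).comp hE.extClass (zero_add 1)) (zero_add 1) =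
      hE.extClass := by
    rw [Ext.mk₀_comp_mk₀_assoc, s.id, Ext.mk₀_id_comp]
  rw [← h]
  erw [hE.comp_extClass]
  rw [Ext.comp_zero]

/-- The torsion class of a finitely generated wide subcategory is generated by a basic support
tilting representation. -/
lemma IsWide.exists_isSupportTilting (hQ : IsAcyclic Q) {A : ObjectProperty (Rep k Q)}
    (hA : IsWide A) (hfg : IsFinitelyGenerated A) :
    ∃ (r : ℕ) (T : Fin r → Rep k Q), (∀ i, Indecomposable (T i)) ∧
      (∀ i j, Nonempty (T i ≅ T j) → i = j) ∧ IsSupportTilting (⨁ T) ∧ wideOf (Gen (⨁ T)) = A := by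
  have : ∀ x y : Q, Finite (Quiver.Path x y) := finite_path hQ
  obtain ⟨n, G, hGA, hgen, hsplit⟩ := hfg.exists_splitProjective k
  have hG := hA.prop_biproduct G hGA
  have := hA.gen_closedUnderExtensions k (ext_two hQ) hG hgen
  obtain ⟨T₀, hT₀, hext, hdet⟩ := exists_extProjective_completion k (ext_two hQ)
    (P := free k (id : Q → Q)) (fun _ => isZero_of_hom_free) (G := ⨁ G)
    fun X hX => ext_biproduct_left fun i => (hsplit i).subsingleton_ext hX
  obtain ⟨r, T, hind, hbasic, hret, ι, _, c, ⟨ρ⟩⟩ := exists_basic_decomposition T₀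
  let σ := fun i => (hret i).some
  have hT₀T : ∀ i, Gen T₀ (T i) := fun i => by
    have : IsSplitEpi (σ i).r := ⟨⟨(σ i).splitEpi⟩⟩
    exact (gen_self T₀).of_epi (σ i).r
  have hGen : Gen (⨁ T) = Gen T₀ := by
    ext X
    refine ⟨fun h => gen_of_jointly_epi k fun W t ht => ?_, fun h => ?_⟩
    · refine h.eq_zero_of_biproduct t fun i f => (hT₀T i).eq_zero _ fun g => ?_
      rw [← Category.assoc, ht]
    · refine gen_of_jointly_epi k fun W t ht => h.eq_zero t fun f => ?_
      have : IsSplitEpi ρ.r := ⟨⟨ρ.splitEpi⟩⟩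
      rw [← cancel_epi ρ.r, comp_zero]
      refine biproduct.hom_ext' _ _ fun i => ?_
      rw [comp_zero, ← cancel_epi (biproduct.π T (c i)), comp_zero]
      simpa using ht (biproduct.π T (c i) ≫ biproduct.ι (fun i => T (c i)) i ≫ ρ.r ≫ f)
  refine ⟨r, T, hind, hbasic, ⟨⟨?_, hasProjectiveDimensionLE_one hQ _⟩, fun M hM hTM => ?_⟩, ?_⟩
  · refine ext_biproduct_left fun i => ext_biproduct_right fun j =>
      ext_retract_left (σ i) (hext _ ?_)
    rw [← hT₀]
    exact hT₀T j
  · rw [hGen]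
    -- `M` is supported on `T₀`, so a projective without nonzero morphisms to `T₀` has none to `M`.
    refine hdet M (fun K hK hKT => hom_eq_zero_of_supp hQ (hM.trans ?_) hKT)
      (ext_retract_left ρ (ext_biproduct_left fun i =>
        ext_retract_left (retractBiproduct T (c i)) hTM))
    exact supp_le_of_gen (hGen ▸ gen_self (⨁ T))
  · rw [hGen, hT₀]
    exact hA.wideOf_gen k hG hgen

end SupportTilting

end QuiverRep

theorem mainTheorem2 {k : Type u} [Field k] [IsAlgClosed k]
    {Q : Type v} [Fintype Q] [Quiver.{w} Q] [∀ x y : Q, Finite (x ⟶ y)]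
    (hQ : QuiverRep.IsAcyclic Q) :
    (∀ M N : QuiverRep.Rep k Q,
      Module.Finite k (M ⟶ N) ∧ Module.Finite k (QuiverRep.Ext1 M N)) ∧
    (∀ (r : ℕ) (T : Fin r → QuiverRep.Rep k Q),
      (∀ i, Indecomposable (T i)) →
      (∀ i j, Nonempty (T i ≅ T j) → i = j) →
      QuiverRep.IsSupportTilting (⨁ T) →
      ∀ (a : Fin r → ℤ) (b : Q → ℤ),
        (∀ i, QuiverRep.IsSplitProjective (QuiverRep.Gen (⨁ T)) (T i) → a i = 0) →
        (∀ i, QuiverRep.IsExtProjective (QuiverRep.Gen (⨁ T)) (T i) →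
          ¬ QuiverRep.IsSplitProjective (QuiverRep.Gen (⨁ T)) (T i) → 0 < a i) →
        (∀ j, j ∉ QuiverRep.supp (⨁ T) → b j < 0) →
        (∃! θ : QuiverRep.K0 Q →+ ℤ, QuiverRep.IsStabilityOf T a b θ) ∧
        ∀ θ : QuiverRep.K0 Q →+ ℤ, QuiverRep.IsStabilityOf T a b θ →
          QuiverRep.wideOf (QuiverRep.Gen (⨁ T)) = QuiverRep.semistable k θ) ∧
    (∀ A : ObjectProperty (QuiverRep.Rep k Q),
      QuiverRep.IsWide A → QuiverRep.IsFinitelyGenerated A →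
      ∃ θ : QuiverRep.K0 Q →+ ℤ, A = QuiverRep.semistable k θ) := by
  classical
  have : ∀ x y : Q, Finite (Quiver.Path x y) := QuiverRep.finite_path hQ
  refine ⟨fun M N => ⟨inferInstance, QuiverRep.finite_ext_one k M N⟩,
    fun r T hind _ hT a b ha₀ ha₁ hb => ⟨QuiverRep.existsUnique_isStabilityOf hQ T a b,
      fun θ hθ => QuiverRep.wideOf_gen_eq_semistable hQ hind hT ha₀ ha₁ hb hθ⟩,
    fun A hA hfg => ?_⟩
  obtain ⟨r, T, hind, _, hT, rfl⟩ := hA.exists_isSupportTilting hQ hfg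
  -- The coefficients need only have the prescribed signs.
  let a : Fin r → ℤ := fun i =>
    if QuiverRep.IsSplitProjective (QuiverRep.Gen (⨁ T)) (T i) then 0 else 1
  obtain ⟨θ, hθ, _⟩ := QuiverRep.existsUnique_isStabilityOf hQ T a fun _ => -1
  exact ⟨θ, QuiverRep.wideOf_gen_eq_semistable hQ hind hT (fun i hi => if_pos hi)
    (fun i _ hi => by simp [hi]) (fun _ _ => neg_one_lt_zero) hθ⟩
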